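/- All vector spaces are over $\mathbb C$. For a $\mathbb C[\partial]$-module $V$ and $F\in V[\lambda_1,\dots,\lambda_{n}]$, the substitution $\lambda_n\mapsto\lambda_n^\dagger=-\lambda_1-\dots-\lambda_{n-1}-\partial$ is made with $\partial$ acting on the coefficients. **Setting.** Let $(\mathcal L,[\cdot_\lambda\cdot],\alpha)$ be a (multiplicative) Hom-Lie conformal algebra: a $\mathbb C[\partial]$-module with a $\mathbb C$-bilinear map $[\cdot_\lambda\cdot]:\mathcal L\times\mathcal L\to\mathcal L[\lambda]$ and a $\mathbb C$-linear map $\alpha$ commuting with $\partial$ such that $[\partial x_\lambda y]=-\lambda[x_\lambda y]$, $[x_\lambda\partial y]=(\partial+\lambda)[x_\lambda y]$, $[x_\lambda y]=-[y_{-\lambda-\partial}x]$, $\alpha([x_\lambda y])=[\alpha(x)_\lambda\alpha(y)]$ and $[\alpha(x)_\lambda[y_\mu z]]=[[x_\lambda y]_{\lambda+\mu}\alpha(z)]+[\alpha(y)_\mu[x_\lambda z]]$. Let $(\rho,\mathcal M,\beta)$ be a representation: $\mathcal M$ is a $\mathbb C[\partial]$-module, $\beta$ a $\mathbb C$-linear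 endomorphism of $\mathcal M$ commuting with $\partial$, and $(x,m)\mapsto\rho(x)_\lambda m\in\mathcal M[\lambda]$ is $\mathbb C$-bilinear with $\rho(\partial x)_\lambda=-\lambda\rho(x)_\lambda$, $\rho(x)_\lambda\partial m=(\partial+\lambda)\rho(x)_\lambda m$, $\beta(\rho(x)_\lambda m)=\rho(\alpha(x))_\lambda\beta(m)$ and $\rho([x_\lambda y])_{\lambda+\mu}\beta=\rho(\alpha(x))_\lambda\rho(y)_\mu-\rho(\alpha(y))_\mu\rho(x)_\lambda$. Let $T:\mathcal M\to\mathcal L$ be an $\mathcal O$-operator: a $\mathbb C[\partial]$-linear map with $T\beta=\alpha T$ and $[T(m)_\lambda T(n)]=T(\rho(T(m))_\lambda n-\rho(T(n))_{-\partial-\lambda}m)$. **Cochains.** For $p\ge1$ let $C^p_{\beta,\alpha}(\mathcal M,\mathcal L)$ be the space of $\mathbb C$-multilinear maps $f_{\lambda_1,\dots,\lambda_{p-1}}:\mathcal M^{\otimes p}\to\mathcal L[\lambda_1,\dots,\lambda_{p-1}]$ with $\alpha\circ f=f\circ\beta^{\otimes p}$ that are conformally sesquilinear (replacing $m_i$ by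 $\partial m_i$ multiplies $f$ by $-\lambda_i$ if $i<p$, and by $\partial+\lambda_1+\dots+\lambda_{p-1}$ if $i=p$) and conformally skew-symmetric ($f_{\lambda_1,\dots,\lambda_{p-1}}(m_1,\dots,m_p)=(-1)^\tau f_{\lambda_{\tau(1)},\dots,\lambda_{\tau(p-1)}}(m_{\tau(1)},\dots,m_{\tau(p)})|_{\lambda_p\mapsto\lambda_p^\dagger}$ for $\tau\in S_p$). **First differential.** The sub-adjacent algebra $\mathcal M^c_\beta=(\mathcal M,[\cdot_\lambda\cdot]^c,\beta)$ has bracket $[m_\lambda n]^c=\rho(T(m))_\lambda n-\rho(T(n))_{-\partial-\lambda}m$. Put $\rho_T(m)_\lambda x=[T(m)_\lambda x]+T(\rho(x)_{-\partial-\lambda}m)$. For $f$ of arity $p$, with $\lambda_{p+1}:=\lambda_{p+1}^\dagger$, and with the last of the indices remaining as subscripts of $f$ not being used, $$\begin{aligned}(\delta_{\beta,\alpha}f)_{\lambda_1,\dots,\lambda_p}(m_1,\dots,m_{p+1})={}&\sum_{i=1}^{p+1}(-1)^{i+1}\rho_T(\beta^{p-1}(m_i))_{\lambda_i}f_{\lambda_1,\dots,\hat{\lambda_i},\dots}(m_1,\dots,\hat{m_i},\dots,m_{p+1})\\&+\sum_{i<j}(-1)^{i+j}f_{\lambda_i+\lambda_j,\lambda_1,\dots,\hat{\lambda_i},\dots,\hat{\lambda_j},\dots}([{m_i}_{\lambda_i}m_j]^c,\beta(m_1),\dots,\hat{m_i},\dots,\hat{m_j},\dots,\beta(m_{p+1})).\end{aligned}$$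 **Second differential.** On maps from tensor powers of $E=\mathcal L\oplus\mathcal M$ to polynomials with values in $E$, with $\gamma=\alpha+\beta$, put for $f,g$ of arities $m,n$ $$(f\circledcirc g)_{\lambda_1,\dots,\lambda_{m+n-2}}(x_1,\dots,x_{m+n-1})=\sum_{\tau\in S_{n,m-1}}(-1)^\tau f_{\lambda_{\tau(1)}+\dots+\lambda_{\tau(n)},\lambda_{\tau(n+1)},\dots,\lambda_{\tau(m+n-2)}}\bigl(g_{\lambda_{\tau(1)},\dots,\lambda_{\tau(n-1)}}(x_{\tau(1)},\dots,x_{\tau(n)}),\gamma^{n-1}(x_{\tau(n+1)}),\dots,\gamma^{n-1}(x_{\tau(m+n-1)})\bigr),$$ the sum being over $(n,m-1)$-shuffles and $\lambda_{m+n-1}:=\lambda_{m+n-1}^\dagger$, and $[f,g]_{NR}=f\circledcirc g-(-1)^{(m-1)(n-1)}g\circledcirc f$. Let $m_c+\rho$ be the semidirect product bracket $[(x+m)_\lambda(y+n)]=[x_\lambda y]+\rho(x)_\lambda n-\rho(y)_{-\partial-\lambda}m$ on $E$. A cochain on $\mathcal M$ with values in $\mathcal L$ is regarded as a cochain on $E$,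 extended by zero. For $f$ of arity $q$ put $\{\!\{f,g\}\!\}=(-1)^q[[m_c+\rho,f]_{NR},g]_{NR}$, and let $\delta_T=\{\!\{T,-\}\!\}$. **Proposition.** $\mathcal M^c_\beta$ is a Hom-Lie conformal algebra and $(\rho_T,\mathcal L,\alpha)$ is a representation of it. For every $p\ge1$, $\delta_{\beta,\alpha}$ and $\delta_T$ map $C^p_{\beta,\alpha}(\mathcal M,\mathcal L)$ to $C^{p+1}_{\beta,\alpha}(\mathcal M,\mathcal L)$ (in particular $\{\!\{T,P\}\!\}$ is again the extension by zero of a cochain on $\mathcal M$ with values in $\mathcal L$), and $$\delta_T(P)=\{\!\{T,P\}\!\}=(-1)^p\,\delta_{\beta,\alpha}(P)\qquad\text{for all }P\in C^p_{\beta,\alpha}(\mathcal M,\mathcal L).$$ Hence on $C^*_{\beta,\alpha}(\mathcal M,\mathcal L)=\bigoplus_{p\ge1}C^p_{\beta,\alpha}(\mathcal M,\mathcal L)$ the two differentials have the same cocycles and the same coboundaries in every degree, and the identity on cocycles induces an isomorphism of their cohomology spaces (cocycles modulo coboundaries, the coboundaries in degree $1$ being zero). -/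

import Mathlib

open TensorProduct

noncomputable section

namespace HomLieConformal

/-! ## Polynomials with coefficients in a vector space

A `ℂ[∂]`-module is a complex vector space `V` together with a `ℂ`-linear endomorphism `∂`. -/

/-- The polynomial ring `ℂ[λ₁, …, λₙ]`; the variable `λᵢ₊₁` is `MvPolynomial.X i`. -/
abbrev Lam (n : ℕ) : Type := MvPolynomial (Fin n) ℂ

/-- `V[λ₁, …, λₙ] = ℂ[λ₁, …, λₙ] ⊗ V`. -/
def VPoly (n : ℕ) (V : Type*) [AddCommGroup V] [Module ℂ V] : Type _ := Lam n ⊗[ℂ] V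

section Polynomials

variable {A V W : Type*} [AddCommGroup A] [Module ℂ A] [AddCommGroup V] [Module ℂ V]
  [AddCommGroup W] [Module ℂ W]

instance (n : ℕ) : AddCommGroup (VPoly n V) := inferInstanceAs (AddCommGroup (Lam n ⊗[ℂ] V))

instance (n : ℕ) : Module ℂ (VPoly n V) := inferInstanceAs (Module ℂ (Lam n ⊗[ℂ] V))

instance (n : ℕ) : Module (Lam n) (VPoly n V) := inferInstanceAs (Module (Lam n) (Lam n ⊗[ℂ] V))

instance (n : ℕ) : IsScalarTower ℂ (Lam n) (VPoly n V) :=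
  inferInstanceAs (IsScalarTower ℂ (Lam n) (Lam n ⊗[ℂ] V))

/-- Apply a linear map `V → W` to the coefficients of a polynomial. -/
def mapCoeff (n : ℕ) (φ : V →ₗ[ℂ] W) : VPoly n V →ₗ[ℂ] VPoly n W := φ.lTensor (Lam n)

/-- The substitution `u(λ₁, …, λₖ) ↦ u(t₁, …, tₖ)` with `tᵢ ∈ ℂ[λ₁, …, λₙ]`. -/
def subst {k n : ℕ} (t : Fin k → Lam n) : VPoly k V →ₗ[ℂ] VPoly n V :=
  (MvPolynomial.aeval t : Lam k →ₐ[ℂ] Lam n).toLinearMap.rTensor V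

/-- The substitution `λₙ₊₁ ↦ λₙ₊₁† = -λ₁ - ⋯ - λₙ - ∂`, with `∂` acting on the coefficients.
The polynomial ring is first mapped to `ℂ[λ₁, …, λₙ] ⊗ ℂ[∂]`, and then `ℂ[∂]` acts on `V`. -/
def dag (n : ℕ) (D : Module.End ℂ V) : VPoly (n + 1) V →ₗ[ℂ] VPoly n V :=
  (TensorProduct.lift (Polynomial.aeval D : Polynomial ℂ →ₐ[ℂ] Module.End ℂ V).toLinearMap).lTensor
      (Lam n) ∘ₗ
    (TensorProduct.assoc ℂ (Lam n) (Polynomial ℂ) V).toLinearMap ∘ₗ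
    (MvPolynomial.aeval
      (Fin.snoc (fun i => MvPolynomial.X i ⊗ₜ[ℂ] (1 : Polynomial ℂ))
        (-(∑ i, MvPolynomial.X i) ⊗ₜ[ℂ] (1 : Polynomial ℂ) - 1 ⊗ₜ[ℂ] Polynomial.X) :
          Fin (n + 1) → Lam n ⊗[ℂ] Polynomial ℂ)).toLinearMap.rTensor V

/-- `u(λ) ↦ u(-λ-∂)`. -/
def opposite (D : Module.End ℂ V) : VPoly 1 V →ₗ[ℂ] VPoly 1 V :=
  dag 1 D ∘ₗ subst (fun _ => MvPolynomial.X 1)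

/-- The `ℂ[λ₁, …, λₙ]`-linear extension of a `ℂ`-linear map `V → W[λ₁, …, λₙ]`. -/
def extend {n : ℕ} (φ : V →ₗ[ℂ] VPoly n W) : VPoly n V →ₗ[Lam n] VPoly n W :=
  LinearMap.liftBaseChange (Lam n) φ

theorem extend_add {n : ℕ} (φ ψ : V →ₗ[ℂ] VPoly n W) : extend (φ + ψ) = extend φ + extend ψ :=
  map_add (LinearMap.liftBaseChangeEquiv (Lam n) (R := ℂ) (M := V) (N := VPoly n W)) φ ψ

theorem extend_smul {n : ℕ} (c : ℂ) (φ : V →ₗ[ℂ] VPoly n W) (u : VPoly n V) :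
    extend (c • φ) u = c • extend φ u := by
  have h : c • φ = (algebraMap ℂ (Lam n) c) • φ := by
    ext v
    exact (algebraMap_smul (Lam n) c (φ v)).symm
  rw [h]
  have := map_smul (LinearMap.liftBaseChangeEquiv (Lam n) (R := ℂ) (M := V) (N := VPoly n W))
    (algebraMap ℂ (Lam n) c) φ
  refine (LinearMap.congr_fun this u).trans ?_
  exact algebraMap_smul (Lam n) c _

/-- For a bilinear map `b : A × V → W[λ]`, written `a_λ v`, and `c ∈ ℂ[λ₁, …, λₙ]`: the map
`v ↦ a_c v`, extended `ℂ[λ₁, …, λₙ]`-linearly to `V[λ₁, …, λₙ] → W[λ₁, …, λₙ]`. -/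
def lamApply {n : ℕ} (b : A →ₗ[ℂ] V →ₗ[ℂ] VPoly 1 W) (c : Lam n) :
    A →ₗ[ℂ] VPoly n V →ₗ[ℂ] VPoly n W where
  toFun a := (extend (subst (fun _ => c) ∘ₗ b a)).restrictScalars ℂ
  map_add' x y := by
    rw [map_add, LinearMap.comp_add, extend_add]
    rfl
  map_smul' r x := by
    rw [map_smul, LinearMap.comp_smul]
    ext u
    exact extend_smul _ _ _

end Polynomials

/-! ## Hom-Lie conformal algebras, representations, `𝒪`-operators -/

section Algebras

variable {A V : Type*} [AddCommGroup A] [Module ℂ A] [AddCommGroup V] [Module ℂ V]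

/-- The `ℂ[∂]`-module `A` with the `λ`-bracket `br x y = [x_λ y]` and the twist map `α` is a
(multiplicative) Hom-Lie conformal algebra. In the Jacobi identity `λ = X 0`, `μ = X 1`. -/
structure IsHomLieConformal (D α : Module.End ℂ A) (br : A →ₗ[ℂ] A →ₗ[ℂ] VPoly 1 A) : Prop where
  twist_der : ∀ x, α (D x) = D (α x)
  der_left : ∀ x y, br (D x) y = -((MvPolynomial.X 0 : Lam 1) • br x y)
  der_right : ∀ x y, br x (D y) = mapCoeff 1 D (br x y) + (MvPolynomial.X 0 : Lam 1) • br x y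
  skew : ∀ x y, br x y = -opposite D (br y x)
  twist_bracket : ∀ x y, mapCoeff 1 α (br x y) = br (α x) (α y)
  jacobi : ∀ x y z,
    lamApply br (MvPolynomial.X 0 : Lam 2) (α x) (subst (fun _ => MvPolynomial.X 1) (br y z)) =
      lamApply br.flip (MvPolynomial.X 0 + MvPolynomial.X 1 : Lam 2) (α z)
          (subst (fun _ => MvPolynomial.X 0) (br x y)) +
        lamApply br (MvPolynomial.X 1 : Lam 2) (α y) (subst (fun _ => MvPolynomial.X 0) (br x z))

/-- `ρ x v = ρ(x)_λ v` together with the endomorphism `β` of the `ℂ[∂]`-module `V` is a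
representation of the Hom-Lie conformal algebra `(A, br, α)` on `V`. -/
structure IsRepresentation (DA α : Module.End ℂ A) (br : A →ₗ[ℂ] A →ₗ[ℂ] VPoly 1 A)
    (DV β : Module.End ℂ V) (ρ : A →ₗ[ℂ] V →ₗ[ℂ] VPoly 1 V) : Prop where
  twist_der : ∀ v, β (DV v) = DV (β v)
  der_left : ∀ x v, ρ (DA x) v = -((MvPolynomial.X 0 : Lam 1) • ρ x v)
  der_right : ∀ x v, ρ x (DV v) = mapCoeff 1 DV (ρ x v) + (MvPolynomial.X 0 : Lam 1) • ρ x v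
  twist_action : ∀ x v, mapCoeff 1 β (ρ x v) = ρ (α x) (β v)
  action_bracket : ∀ x y v,
    lamApply ρ.flip (MvPolynomial.X 0 + MvPolynomial.X 1 : Lam 2) (β v)
        (subst (fun _ => MvPolynomial.X 0) (br x y)) =
      lamApply ρ (MvPolynomial.X 0 : Lam 2) (α x) (subst (fun _ => MvPolynomial.X 1) (ρ y v)) -
        lamApply ρ (MvPolynomial.X 1 : Lam 2) (α y) (subst (fun _ => MvPolynomial.X 0) (ρ x v))

/-- `T : V → A` is an `𝒪`-operator on `(A, br, α)` with respect to `(ρ, V, β)`. -/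
structure IsOOperator (DA α : Module.End ℂ A) (br : A →ₗ[ℂ] A →ₗ[ℂ] VPoly 1 A)
    (DV β : Module.End ℂ V) (ρ : A →ₗ[ℂ] V →ₗ[ℂ] VPoly 1 V) (T : V →ₗ[ℂ] A) : Prop where
  map_der : ∀ m, T (DV m) = DA (T m)
  map_twist : ∀ m, T (β m) = α (T m)
  bracket : ∀ m n, br (T m) (T n) = mapCoeff 1 T (ρ (T m) n - opposite DV (ρ (T n) m))

/-- The product `m *_λ n = ρ(T m)_λ n` of the Hom-pre-Lie conformal algebra induced by `T`. -/
def preLieProduct (ρ : A →ₗ[ℂ] V →ₗ[ℂ] VPoly 1 V) (T : V →ₗ[ℂ] A) :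
    V →ₗ[ℂ] V →ₗ[ℂ] VPoly 1 V :=
  ρ ∘ₗ T

/-- The commutator bracket `[m_λ n]ᶜ = m *_λ n - n *_{-∂-λ} m`. -/
def commutatorBracket (D : Module.End ℂ V) (p : V →ₗ[ℂ] V →ₗ[ℂ] VPoly 1 V) :
    V →ₗ[ℂ] V →ₗ[ℂ] VPoly 1 V :=
  p - p.flip.compr₂ (opposite D)

/-- The `λ`-bracket of the sub-adjacent Hom-Lie conformal algebra `Vᶜ_β`. -/
def subadjacentBracket (DV : Module.End ℂ V) (ρ : A →ₗ[ℂ] V →ₗ[ℂ] VPoly 1 V) (T : V →ₗ[ℂ] A) :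
    V →ₗ[ℂ] V →ₗ[ℂ] VPoly 1 V :=
  commutatorBracket DV (preLieProduct ρ T)

/-- `ρ_T(m)_λ x = [T m_λ x] + T(ρ(x)_{-∂-λ} m)`. -/
def inducedAction (br : A →ₗ[ℂ] A →ₗ[ℂ] VPoly 1 A) (DV : Module.End ℂ V)
    (ρ : A →ₗ[ℂ] V →ₗ[ℂ] VPoly 1 V) (T : V →ₗ[ℂ] A) : V →ₗ[ℂ] A →ₗ[ℂ] VPoly 1 A :=
  br ∘ₗ T + ρ.flip.compr₂ (mapCoeff 1 T ∘ₗ opposite DV)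

end Algebras

/-! ## Cochains -/

/-- `ℂ`-multilinear maps `f_{λ₁,…,λₖ} : A^{⊗(k+1)} → V[λ₁, …, λₖ]`; the index `k` belongs to
arity `p = k + 1`. -/
abbrev PreCochain (k : ℕ) (A V : Type*) [AddCommGroup A] [Module ℂ A] [AddCommGroup V]
    [Module ℂ V] : Type _ :=
  MultilinearMap ℂ (fun _ : Fin (k + 1) => A) (VPoly k V)

section Cochains

variable {A V : Type*} [AddCommGroup A] [Module ℂ A] [AddCommGroup V] [Module ℂ V]

/-- The conditions defining the space `C^{k+1}` of cochains with values in `V` on the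
`ℂ[∂]`-module `A` with twist maps `α` on `A` and `β` on `V`: compatibility with the twist maps,
conformal sesquilinearity and conformal skew-symmetry. -/
structure IsCochain (DA α : Module.End ℂ A) (DV β : Module.End ℂ V) {k : ℕ}
    (f : PreCochain k A V) : Prop where
  twist : ∀ x, mapCoeff k β (f x) = f (fun i => α (x i))
  der : ∀ (x : Fin (k + 1) → A) (i : Fin k),
    f (Function.update x i.castSucc (DA (x i.castSucc))) = -((MvPolynomial.X i : Lam k) • f x)
  der_last : ∀ x : Fin (k + 1) → A,
    f (Function.update x (Fin.last k) (DA (x (Fin.last k)))) =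
      mapCoeff k DV (f x) + (∑ i, MvPolynomial.X i : Lam k) • f x
  skew : ∀ (τ : Equiv.Perm (Fin (k + 1))) (x : Fin (k + 1) → A),
    f x = (Equiv.Perm.sign τ : ℤ) •
      dag k DV (subst (fun i : Fin k => MvPolynomial.X (τ i.castSucc)) (f (fun i => x (τ i))))

/-- The space `C^{k+1}(A, V)` of cochains. -/
def cochains (DA α : Module.End ℂ A) (DV β : Module.End ℂ V) (k : ℕ) :
    Submodule ℂ (PreCochain k A V) where
  carrier := {f | IsCochain DA α DV β f}
  zero_mem' := ⟨by simp, by simp, by simp, by simp⟩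
  add_mem' := by
    intro f g hf hg
    refine ⟨fun x => ?_, fun x i => ?_, fun x => ?_, fun τ x => ?_⟩
    · simp [hf.twist, hg.twist]
    · simp [hf.der, hg.der, add_comm]
    · simp [hf.der_last, hg.der_last, add_add_add_comm]
    · rw [add_apply, hf.skew τ x, hg.skew τ x]
      simp
  smul_mem' := by
    intro c f hf
    refine ⟨fun x => ?_, fun x i => ?_, fun x => ?_, fun τ x => ?_⟩
    · simp [hf.twist]
    · simp [hf.der, smul_comm c]
    · simp [hf.der_last, smul_comm c]
    · rw [smul_apply, hf.skew τ x]
      simp [smul_comm c]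

/-- A linear map, seen as a cochain of arity one. -/
def ofLinear (T : A →ₗ[ℂ] V) : PreCochain 0 A V :=
  (TensorProduct.mk ℂ (Lam 0) V 1 ∘ₗ T).compMultilinearMap
    (MultilinearMap.ofSubsingleton ℂ A A (0 : Fin 1) LinearMap.id)

/-- A bilinear map `A × A → V[λ]`, seen as a cochain of arity two. -/
def ofBilinear (b : A →ₗ[ℂ] A →ₗ[ℂ] VPoly 1 V) : PreCochain 1 A V where
  toFun x := b (x 0) (x 1)
  map_update_add' x i y z := by
    fin_cases i <;> simp [Function.update]
  map_update_smul' x i c y := by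
    fin_cases i <;> simp [Function.update]

/-- `f(·, y₁, …, yₖ)`. -/
def firstArgument {k : ℕ} (f : PreCochain k A V) (y : Fin k → A) : A →ₗ[ℂ] VPoly k V where
  toFun a := f (Fin.cons a y)
  map_add' := f.cons_add y
  map_smul' c a := f.cons_smul y c a

/-- Insertion in the first argument: `insertFirst t f y u = f_{t₁,…,tₖ}(u, y₁, …, yₖ)` for
`u ∈ A[λ₁, …, λₙ]`, extended `ℂ[λ₁, …, λₙ]`-linearly in `u`. -/
def insertFirst {k n : ℕ} (t : Fin k → Lam n) (f : PreCochain k A V) :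
    MultilinearMap ℂ (fun _ : Fin k => A) (VPoly n A →ₗ[ℂ] VPoly n V) where
  toFun y := (extend (subst t ∘ₗ firstArgument f y)).restrictScalars ℂ
  map_update_add' y i a b := by
    have h : firstArgument f (Function.update y i (a + b)) =
        firstArgument f (Function.update y i a) + firstArgument f (Function.update y i b) := by
      ext v
      exact (f.curryLeft v).map_update_add y i a b
    rw [h, LinearMap.comp_add, extend_add]
    rfl
  map_update_smul' y i c a := by
    have h : firstArgument f (Function.update y i (c • a)) =
        c • firstArgument f (Function.update y i a) := by
      ext v
      exact (f.curryLeft v).map_update_smul y i c a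
    rw [h, LinearMap.comp_smul]
    ext u
    exact extend_smul _ _ _

theorem insertFirst_add {k n : ℕ} (t : Fin k → Lam n) (f g : PreCochain k A V) :
    insertFirst t (f + g) = insertFirst t f + insertFirst t g := by
  ext1 y
  have h : firstArgument (f + g) y = firstArgument f y + firstArgument g y := rfl
  change (extend (subst t ∘ₗ firstArgument (f + g) y)).restrictScalars ℂ = _
  rw [h, LinearMap.comp_add, extend_add]
  rfl

theorem insertFirst_smul {k n : ℕ} (t : Fin k → Lam n) (c : ℂ) (f : PreCochain k A V) :
    insertFirst t (c • f) = c • insertFirst t f := by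
  ext1 y
  have h : firstArgument (c • f) y = c • firstArgument f y := rfl
  change (extend (subst t ∘ₗ firstArgument (c • f) y)).restrictScalars ℂ = _
  rw [h, LinearMap.comp_smul]
  ext u
  exact extend_smul _ _ _

/-- If the maps `a : ι → ν` and `b : κ → ν` split `ν` into two blocks, the multilinear map
`x ↦ H (x ∘ b) (G (x ∘ a))`. -/
def glue {ι κ ν X Y : Type*} [AddCommGroup X] [Module ℂ X] [AddCommGroup Y] [Module ℂ Y]
    (a : ι → ν) (b : κ → ν) (hab : Function.Bijective (Sum.elim a b))
    (H : MultilinearMap ℂ (fun _ : κ => A) (X →ₗ[ℂ] Y)) (G : MultilinearMap ℂ (fun _ : ι => A) X) :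
    MultilinearMap ℂ (fun _ : ν => A) Y where
  toFun x := H (fun j => x (b j)) (G (fun i => x (a i)))
  map_update_add' x n y z := by
    classical
    obtain ⟨i | j, rfl⟩ := hab.2 n
    · have hb : ∀ w, (fun j => Function.update x (a i) w (b j)) = fun j => x (b j) := fun w =>
        Function.update_comp_eq_of_forall_ne x w
          fun j h => Sum.inl_ne_inr (hab.1 (a₁ := Sum.inl i) (a₂ := Sum.inr j) h.symm)
      have ha : ∀ w, (fun j => Function.update x (a i) w (a j)) =
          Function.update (fun j => x (a j)) i w := fun w =>
        Function.update_comp_eq_of_injective x (hab.1.comp Sum.inl_injective) i w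
      simp [hb, ha]
    · have ha : ∀ w, (fun i => Function.update x (b j) w (a i)) = fun i => x (a i) := fun w =>
        Function.update_comp_eq_of_forall_ne x w
          fun i h => Sum.inl_ne_inr (hab.1 (a₁ := Sum.inl i) (a₂ := Sum.inr j) h)
      have hb : ∀ w, (fun i => Function.update x (b j) w (b i)) =
          Function.update (fun i => x (b i)) j w := fun w =>
        Function.update_comp_eq_of_injective x (hab.1.comp Sum.inr_injective) j w
      simp [hb, ha]
  map_update_smul' x n c y := by
    classical
    obtain ⟨i | j, rfl⟩ := hab.2 n
    · have hb : ∀ w, (fun j => Function.update x (a i) w (b j)) = fun j => x (b j) := fun w =>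
        Function.update_comp_eq_of_forall_ne x w
          fun j h => Sum.inl_ne_inr (hab.1 (a₁ := Sum.inl i) (a₂ := Sum.inr j) h.symm)
      have ha : ∀ w, (fun j => Function.update x (a i) w (a j)) =
          Function.update (fun j => x (a j)) i w := fun w =>
        Function.update_comp_eq_of_injective x (hab.1.comp Sum.inl_injective) i w
      simp [hb, ha]
    · have ha : ∀ w, (fun i => Function.update x (b j) w (a i)) = fun i => x (a i) := fun w =>
        Function.update_comp_eq_of_forall_ne x w
          fun i h => Sum.inl_ne_inr (hab.1 (a₁ := Sum.inl i) (a₂ := Sum.inr j) h)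
      have hb : ∀ w, (fun i => Function.update x (b j) w (b i)) =
          Function.update (fun i => x (b i)) j w := fun w =>
        Function.update_comp_eq_of_injective x (hab.1.comp Sum.inr_injective) j w
      simp [hb, ha]

end Cochains

/-! ## The Chevalley–Eilenberg type differential -/

section Differential

variable {A V : Type*} [AddCommGroup A] [Module ℂ A] [AddCommGroup V] [Module ℂ V]

theorem bijective_single {k : ℕ} (i : Fin (k + 2)) :
    Function.Bijective (Sum.elim i.succAbove (fun _ : Fin 1 => i)) := by
  refine ⟨Function.Injective.sumElim Fin.succAbove_right_injective
    (fun a b _ => Subsingleton.elim a b) (fun a _ => Fin.succAbove_ne i a), fun n => ?_⟩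
  rcases eq_or_ne n i with rfl | h
  · exact ⟨Sum.inr 0, rfl⟩
  · obtain ⟨m, rfl⟩ := Fin.exists_succAbove_eq h
    exact ⟨Sum.inl m, rfl⟩

theorem bijective_pair {k : ℕ} (j : Fin (k + 2)) (i : Fin (k + 1)) :
    Function.Bijective (Sum.elim ![j.succAbove i, j] (fun l => j.succAbove (i.succAbove l))) := by
  constructor
  · refine Function.Injective.sumElim ?_
      (Fin.succAbove_right_injective.comp Fin.succAbove_right_injective) ?_
    · intro a b
      fin_cases a <;> fin_cases b <;> simp [Fin.succAbove_ne, Fin.ne_succAbove]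
    · intro a l
      fin_cases a
      · simp
      · simp
  · intro n
    rcases eq_or_ne n j with rfl | h
    · exact ⟨Sum.inl 1, rfl⟩
    · obtain ⟨m, rfl⟩ := Fin.exists_succAbove_eq h
      rcases eq_or_ne m i with rfl | h'
      · exact ⟨Sum.inl 0, rfl⟩
      · obtain ⟨l, rfl⟩ := Fin.exists_succAbove_eq h'
        exact ⟨Sum.inr l, rfl⟩

/-- `x ↦ ρ(αᵏ(xᵢ))_{λᵢ} f_{λ₁,…,λ̂ᵢ,…}(x₁, …, x̂ᵢ, …)`, computed with formal variables
`λ₁, …, λₖ₊₂`; the last variable that remains after removing `λᵢ` is not used by `f`. -/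
def actionTerm (α : Module.End ℂ A) (ρ : A →ₗ[ℂ] V →ₗ[ℂ] VPoly 1 V) {k : ℕ} (f : PreCochain k A V)
    (i : Fin (k + 2)) : MultilinearMap ℂ (fun _ : Fin (k + 2) => A) (VPoly (k + 2) V) :=
  glue i.succAbove (fun _ : Fin 1 => i) (bijective_single i)
    ((lamApply ρ (MvPolynomial.X i : Lam (k + 2)) ∘ₗ α ^ k).compMultilinearMap
      (MultilinearMap.ofSubsingleton ℂ A A (0 : Fin 1) LinearMap.id))
    ((subst (fun l : Fin k => (MvPolynomial.X (i.succAbove l.castSucc) : Lam (k + 2)))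
      ).compMultilinearMap f)

/-- For `i < j` (where the position `i` is written as `j.succAbove i`):
`x ↦ f_{λᵢ+λⱼ,λ₁,…,λ̂ᵢ,…,λ̂ⱼ,…}([xᵢ_{λᵢ} xⱼ], α(x₁), …, x̂ᵢ, …, x̂ⱼ, …)`, computed with formal
variables `λ₁, …, λₖ₊₂`; again the last one of the subscripts of `f` is not used. -/
def bracketTerm (α : Module.End ℂ A) (br : A →ₗ[ℂ] A →ₗ[ℂ] VPoly 1 A) {k : ℕ}
    (f : PreCochain k A V) (j : Fin (k + 2)) (i : Fin (k + 1)) :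
    MultilinearMap ℂ (fun _ : Fin (k + 2) => A) (VPoly (k + 2) V) :=
  glue ![j.succAbove i, j] (fun l => j.succAbove (i.succAbove l)) (bijective_pair j i)
    ((insertFirst
        (fun l : Fin k => (Fin.cons (MvPolynomial.X (j.succAbove i) + MvPolynomial.X j)
          (fun l : Fin k => MvPolynomial.X (j.succAbove (i.succAbove l))) :
            Fin (k + 1) → Lam (k + 2)) l.castSucc) f).compLinearMap (fun _ => α))
    ((subst (fun _ => (MvPolynomial.X (j.succAbove i) : Lam (k + 2)))).compMultilinearMap
      (ofBilinear br))

/-- The differential `C^{k+1}(A, V) → C^{k+2}(A, V)` of the algebra `(A, br, α)` with coefficients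
in `(ρ, V)`, `DV` being the action of `∂` on `V`. Indices start from zero, so that the signs are
`(-1)^i` and `(-1)^{i+j}`; at the end `λₖ₊₂` is replaced by `λₖ₊₂†`. -/
def differential (α : Module.End ℂ A) (br : A →ₗ[ℂ] A →ₗ[ℂ] VPoly 1 A) (DV : Module.End ℂ V)
    (ρ : A →ₗ[ℂ] V →ₗ[ℂ] VPoly 1 V) (k : ℕ) : PreCochain k A V →ₗ[ℂ] PreCochain (k + 1) A V where
  toFun f := (dag (k + 1) DV).compMultilinearMap
    (∑ i : Fin (k + 2), (-1 : ℂ) ^ (i : ℕ) • actionTerm α ρ f i +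
      ∑ j : Fin (k + 2), ∑ i : Fin (k + 1),
        if i.castSucc < j then (-1 : ℂ) ^ ((i : ℕ) + (j : ℕ)) • bracketTerm α br f j i else 0)
  map_add' f g := by
    have h₁ : ∀ i, actionTerm α ρ (f + g) i = actionTerm α ρ f i + actionTerm α ρ g i := fun i => by
      ext x
      simp [actionTerm, glue]
    have h₂ : ∀ j i, bracketTerm α br (f + g) j i =
        bracketTerm α br f j i + bracketTerm α br g j i := fun j i => by
      ext x
      simp [bracketTerm, glue, insertFirst_add]
    ext x
    simp only [h₁, h₂, smul_add, Finset.sum_add_distrib, ite_add_zero]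
    simp only [LinearMap.compMultilinearMap_apply, add_apply, map_add]
    abel
  map_smul' c f := by
    have h₁ : ∀ i, actionTerm α ρ (c • f) i = c • actionTerm α ρ f i := fun i => by
      ext x
      simp [actionTerm, glue]
    have h₂ : ∀ j i, bracketTerm α br (c • f) j i = c • bracketTerm α br f j i := fun j i => by
      ext x
      simp [bracketTerm, glue, insertFirst_smul]
    ext x
    simp only [h₁, h₂, smul_comm _ c, ← Finset.smul_sum, ← smul_add, ← smul_ite_zero]
    simp only [LinearMap.compMultilinearMap_apply, smul_apply, map_smul, RingHom.id_apply]

end Differential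

/-! ## The Nijenhuis–Richardson bracket -/

section NijenhuisRichardson

variable {V : Type*} [AddCommGroup V] [Module ℂ V]

/-- `τ` is an `(a, n - a)`-shuffle: it is increasing on the first `a` and on the last `n - a`
positions. -/
def IsShuffle {n : ℕ} (a : ℕ) (τ : Equiv.Perm (Fin n)) : Prop :=
  ∀ i j : Fin n, i < j → ((j : ℕ) < a ∨ a ≤ (i : ℕ)) → τ i < τ j

instance {n : ℕ} (a : ℕ) : DecidablePred (IsShuffle (n := n) a) := fun τ => by
  unfold IsShuffle
  infer_instance

/-- The first `l + 1` positions. -/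
def headPos {k l N : ℕ} (h : k + l = N) (i : Fin (l + 1)) : Fin (N + 1) := ⟨i, by omega⟩

/-- The last `k` positions. -/
def tailPos {k l N : ℕ} (h : k + l = N) (j : Fin k) : Fin (N + 1) := ⟨l + 1 + j, by omega⟩

theorem bijective_blocks {k l N : ℕ} (h : k + l = N) (τ : Equiv.Perm (Fin (N + 1))) :
    Function.Bijective
      (Sum.elim (fun i => τ (headPos h i)) (fun j => τ (tailPos h j))) := by
  have h₀ : Function.Bijective (Sum.elim (headPos h) (tailPos h)) := by
    constructor
    · refine Function.Injective.sumElim (fun a b e => ?_) (fun a b e => ?_) (fun a b e => ?_)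
      · simpa [headPos, Fin.ext_iff] using e
      · simpa [tailPos, Fin.ext_iff] using e
      · simp only [headPos, tailPos, Fin.mk.injEq] at e
        omega
    · intro n
      by_cases hn : (n : ℕ) < l + 1
      · exact ⟨Sum.inl ⟨n, hn⟩, rfl⟩
      · exact ⟨Sum.inr ⟨n - (l + 1), by omega⟩, Fin.ext (by simp [tailPos]; omega)⟩
  have := τ.bijective.comp h₀
  rwa [Sum.comp_elim] at this

/-- One summand of the circle product: for arities `m = k + 1` of `f` and `n = l + 1` of `g`,
`x ↦ f_{λ_{τ(1)}+⋯+λ_{τ(n)}, λ_{τ(n+1)}, …, λ_{τ(m+n-2)}}(g_{λ_{τ(1)}, …, λ_{τ(n-1)}}(x_{τ(1)}, …,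
x_{τ(n)}), α^{n-1}(x_{τ(n+1)}), …, α^{n-1}(x_{τ(m+n-1)}))`, with formal variables
`λ₁, …, λ_{m+n-1}`. -/
def circTerm (α : Module.End ℂ V) {k l N : ℕ} (h : k + l = N) (f : PreCochain k V V)
    (g : PreCochain l V V) (τ : Equiv.Perm (Fin (N + 1))) :
    MultilinearMap ℂ (fun _ : Fin (N + 1) => V) (VPoly (N + 1) V) :=
  glue (fun i => τ (headPos h i)) (fun j => τ (tailPos h j)) (bijective_blocks h τ)
    ((insertFirst
        (fun j : Fin k => (Fin.cons (∑ i, MvPolynomial.X (τ (headPos h i)))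
          (fun j : Fin k => MvPolynomial.X (τ (tailPos h j))) :
            Fin (k + 1) → Lam (N + 1)) j.castSucc) f).compLinearMap (fun _ => α ^ l))
    ((subst (fun i : Fin l => (MvPolynomial.X (τ (headPos h i.castSucc)) : Lam (N + 1)))
      ).compMultilinearMap g)

/-- The circle product `f ⊚ g` of cochains of arities `m = k + 1` and `n = l + 1`, a sum over
`(n, m - 1)`-shuffles. -/
def circ (D α : Module.End ℂ V) {k l N : ℕ} (h : k + l = N) (f : PreCochain k V V)
    (g : PreCochain l V V) : PreCochain N V V :=
  (dag N D).compMultilinearMap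
    (∑ τ ∈ Finset.univ.filter (IsShuffle (n := N + 1) (l + 1)),
      (Equiv.Perm.sign τ : ℤ) • circTerm α h f g τ)

theorem circ_add_left (D α : Module.End ℂ V) {k l N : ℕ} (h : k + l = N)
    (f f' : PreCochain k V V) (g : PreCochain l V V) :
    circ D α h (f + f') g = circ D α h f g + circ D α h f' g := by
  have h₁ : ∀ τ, circTerm α h (f + f') g τ = circTerm α h f g τ + circTerm α h f' g τ := fun τ => by
    ext x
    simp [circTerm, glue, insertFirst_add]
  ext x
  simp only [circ, h₁, smul_add, Finset.sum_add_distrib]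
  simp only [LinearMap.compMultilinearMap_apply, add_apply, map_add]

theorem circ_add_right (D α : Module.End ℂ V) {k l N : ℕ} (h : k + l = N)
    (f : PreCochain k V V) (g g' : PreCochain l V V) :
    circ D α h f (g + g') = circ D α h f g + circ D α h f g' := by
  have h₁ : ∀ τ, circTerm α h f (g + g') τ = circTerm α h f g τ + circTerm α h f g' τ := fun τ => by
    ext x
    simp [circTerm, glue]
  ext x
  simp only [circ, h₁, smul_add, Finset.sum_add_distrib]
  simp only [LinearMap.compMultilinearMap_apply, add_apply, map_add]

theorem circ_smul_left (D α : Module.End ℂ V) {k l N : ℕ} (h : k + l = N) (c : ℂ)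
    (f : PreCochain k V V) (g : PreCochain l V V) :
    circ D α h (c • f) g = c • circ D α h f g := by
  have h₁ : ∀ τ, circTerm α h (c • f) g τ = c • circTerm α h f g τ := fun τ => by
    ext x
    simp [circTerm, glue, insertFirst_smul]
  ext x
  simp only [circ, h₁, smul_comm _ c, ← Finset.smul_sum]
  simp only [LinearMap.compMultilinearMap_apply, smul_apply, map_smul]

theorem circ_smul_right (D α : Module.End ℂ V) {k l N : ℕ} (h : k + l = N) (c : ℂ)
    (f : PreCochain k V V) (g : PreCochain l V V) :
    circ D α h f (c • g) = c • circ D α h f g := by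
  have h₁ : ∀ τ, circTerm α h f (c • g) τ = c • circTerm α h f g τ := fun τ => by
    ext x
    simp [circTerm, glue]
  ext x
  simp only [circ, h₁, smul_comm _ c, ← Finset.smul_sum]
  simp only [LinearMap.compMultilinearMap_apply, smul_apply, map_smul]

/-- The Nijenhuis–Richardson bracket `[f, g] = f ⊚ g - (-1)^{(m-1)(n-1)} g ⊚ f`. -/
def nrBracket (D α : Module.End ℂ V) {k l N : ℕ} (h : k + l = N) (f : PreCochain k V V)
    (g : PreCochain l V V) : PreCochain N V V :=
  circ D α h f g - (-1 : ℂ) ^ (k * l) • circ D α ((add_comm l k).trans h) g f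

end NijenhuisRichardson

/-! ## The derived bracket -/

section DerivedBracket

variable {L M : Type*} [AddCommGroup L] [Module ℂ L] [AddCommGroup M] [Module ℂ M]

/-- The semidirect product bracket
`[(x + m)_λ (y + n)] = [x_λ y] + ρ(x)_λ n - ρ(y)_{-∂-λ} m` on `L ⊕ M`, that is `m_c + ρ`. -/
def semidirectBracket (br : L →ₗ[ℂ] L →ₗ[ℂ] VPoly 1 L) (DM : Module.End ℂ M)
    (ρ : L →ₗ[ℂ] M →ₗ[ℂ] VPoly 1 M) : (L × M) →ₗ[ℂ] (L × M) →ₗ[ℂ] VPoly 1 (L × M) :=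
  (br.compl₁₂ (LinearMap.fst ℂ L M) (LinearMap.fst ℂ L M)).compr₂
      (mapCoeff 1 (LinearMap.inl ℂ L M)) +
    (ρ.compl₁₂ (LinearMap.fst ℂ L M) (LinearMap.snd ℂ L M)).compr₂
      (mapCoeff 1 (LinearMap.inr ℂ L M)) -
    (ρ.flip.compl₁₂ (LinearMap.snd ℂ L M) (LinearMap.fst ℂ L M)).compr₂
      (mapCoeff 1 (LinearMap.inr ℂ L M) ∘ₗ opposite DM)

/-- A cochain on `M` with values in `L`, seen as a cochain on `L ⊕ M` with values in `L ⊕ M`. -/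
def lift {k : ℕ} : PreCochain k M L →ₗ[ℂ] PreCochain k (L × M) (L × M) where
  toFun f := (mapCoeff k (LinearMap.inl ℂ L M)).compMultilinearMap
    (f.compLinearMap fun _ => LinearMap.snd ℂ L M)
  map_add' f g := by
    ext x
    simp
  map_smul' c f := by
    ext x
    simp

/-- The component `M^{⊗(k+1)} → L[λ₁, …, λₖ]` of a cochain on `L ⊕ M`. -/
def component {k : ℕ} : PreCochain k (L × M) (L × M) →ₗ[ℂ] PreCochain k M L where
  toFun f := (mapCoeff k (LinearMap.fst ℂ L M)).compMultilinearMap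
    (f.compLinearMap fun _ => LinearMap.inr ℂ L M)
  map_add' f g := by
    ext x
    simp
  map_smul' c f := by
    ext x
    simp

/-- The derived bracket `{{f, g}} = (-1)^q [[m_c + ρ, f], g]`, in the cochains on `L ⊕ M`, for `f`
of arity `q = k + 1` and `g` of arity `p = l + 1`. -/
def derivedBracket (DL αL : Module.End ℂ L) (br : L →ₗ[ℂ] L →ₗ[ℂ] VPoly 1 L)
    (DM βM : Module.End ℂ M) (ρ : L →ₗ[ℂ] M →ₗ[ℂ] VPoly 1 M) {k l N : ℕ} (h : 1 + k + l = N)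
    (f : PreCochain k M L) (g : PreCochain l M L) : PreCochain N (L × M) (L × M) :=
  (-1 : ℂ) ^ (k + 1) •
    nrBracket (DL.prodMap DM) (αL.prodMap βM) h
      (nrBracket (DL.prodMap DM) (αL.prodMap βM) rfl
        (ofBilinear (semidirectBracket br DM ρ)) (lift f)) (lift g)

/-- The differential `δ_T = {{T, -}}`, as a map from cochains of arity `k + 1` on `M` with values in
`L` to such cochains of arity `k + 2`. -/
def oDifferential (DL αL : Module.End ℂ L) (br : L →ₗ[ℂ] L →ₗ[ℂ] VPoly 1 L)
    (DM βM : Module.End ℂ M) (ρ : L →ₗ[ℂ] M →ₗ[ℂ] VPoly 1 M) (T : M →ₗ[ℂ] L) (k : ℕ) :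
    PreCochain k M L →ₗ[ℂ] PreCochain (k + 1) M L where
  toFun P := component
    (derivedBracket DL αL br DM βM ρ (Nat.add_comm 1 k) (ofLinear T) P)
  map_add' P Q := by
    rw [← map_add]
    congr 1
    simp only [derivedBracket, nrBracket, map_add, circ_add_left, circ_add_right, smul_add,
      smul_sub]
    abel
  map_smul' c P := by
    rw [RingHom.id_apply, ← map_smul]
    congr 1
    simp only [derivedBracket, nrBracket, map_smul, circ_smul_left, circ_smul_right, smul_sub,
      smul_comm _ c]

end DerivedBracket

/-! ## Cohomology

For a graded space `⊕_{p ≥ 1} C^p` with a differential `d`; as before, `k` stands for `p = k + 1`. -/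

section Cohomology

variable {A V : Type*} [AddCommGroup A] [Module ℂ A] [AddCommGroup V] [Module ℂ V]

/-- The cocycles of arity `k + 1`. -/
def cocycles (C : (k : ℕ) → Submodule ℂ (PreCochain k A V))
    (d : (k : ℕ) → PreCochain k A V →ₗ[ℂ] PreCochain (k + 1) A V) (k : ℕ) :
    Submodule ℂ (PreCochain k A V) :=
  C k ⊓ LinearMap.ker (d k)

/-- The coboundaries of arity `k + 1`; those of arity one are zero, as `p ≥ 1`. -/
def coboundaries (C : (k : ℕ) → Submodule ℂ (PreCochain k A V))
    (d : (k : ℕ) → PreCochain k A V →ₗ[ℂ] PreCochain (k + 1) A V) :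
    (k : ℕ) → Submodule ℂ (PreCochain k A V)
  | 0 => ⊥
  | k + 1 => (C k).map (d k)

/-- The cohomology space of degree `k + 1`: cocycles modulo coboundaries. -/
abbrev Cohomology (C : (k : ℕ) → Submodule ℂ (PreCochain k A V))
    (d : (k : ℕ) → PreCochain k A V →ₗ[ℂ] PreCochain (k + 1) A V) (k : ℕ) : Type _ :=
  cocycles C d k ⧸ (coboundaries C d k).submoduleOf (cocycles C d k)

end Cohomology

end HomLieConformal
end

open HomLieConformal

/-!
A polynomial `f ∈ V[λ₁, …, λₙ]` carries the same information as its class in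
`V[λ₁, …, λₙ₊₁] / (λ₁ + ⋯ + λₙ₊₁ + ∂)`, because the substitution `λₙ₊₁ ↦ λₙ₊₁†` identifies the two
spaces. In the quotient all the variables play the same role: sesquilinearity says that `∂` on the
`i`-th argument is `-λᵢ` for every `i`, skew-symmetry is ordinary skew-symmetry in the pairs
`(λᵢ, xᵢ)`, and `u(-λ-∂)` is `u` with `λ` replaced by the sum of the other variables. The proof
therefore computes modulo the submodules `killed D s = (s + ∂) V[λ₁, …, λₙ]`. The lemma behind it
is `subst_dag_smodEq`, which describes `dag` modulo such a submodule; `eq_of_incl_smodEq` brings an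
identity back from the quotient.

The Jacobi identity of the sub-adjacent bracket and the representation identity of `ρ_T` then
follow by expanding the double brackets: the terms in which `T` is applied to a product are
rewritten by the identity of a representation or of an `𝒪`-operator, and the rest cancels in pairs.

For the two differentials, `[m_c + ρ, T]` is computed first: it is the bracket
`derivedSemidirect`, which is `[· ·]ᶜ` on `M`, `ρ_T` between `M` and `L`, and zero on `L`
(`nrBracket_semidirectBracket`). An `(l + 1, 1)`-shuffle is determined by its last value, and a
`(2, k)`-shuffle by its first two, so the circle products of this bracket with `P` are the two sums
of the differential `δ_{β,α}`, up to the sign `(-1)^p` (`derivedBracket_eq`).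

That the differentials preserve cochains is a property of the circle product (`isCochain_circ`).
Every permutation is uniquely a shuffle times a permutation of the two blocks, and for cochains
the signed summand does not change under the latter. The sum over shuffles is thus a multiple of
the sum over all permutations, and hence skew-symmetric.
-/

noncomputable section

namespace HomLieConformal

/-! ### Polynomials with coefficients in a vector space -/

section Polynomials

variable {A V W : Type*} [AddCommGroup A] [Module ℂ A] [AddCommGroup V] [Module ℂ V]
  [AddCommGroup W] [Module ℂ W]

/-- The constant polynomials. -/
def const (n : ℕ) : V →ₗ[ℂ] VPoly n V := TensorProduct.mk ℂ (Lam n) V 1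

theorem smul_const {n : ℕ} (p : Lam n) (v : V) :
    p • const n v = (p ⊗ₜ[ℂ] v : Lam n ⊗[ℂ] V) := by
  change p • ((1 : Lam n) ⊗ₜ[ℂ] v) = _
  rw [TensorProduct.smul_tmul', smul_eq_mul, mul_one]

/-- Every polynomial is a sum of terms `p v` with `p ∈ ℂ[λ₁, …, λₙ]` and `v ∈ V`. -/
@[elab_as_elim]
theorem VPoly.induction_smul_const {n : ℕ} {P : VPoly n V → Prop} (u : VPoly n V)
    (smul_const : ∀ (p : Lam n) v, P (p • const n v))
    (add : ∀ u v, P u → P v → P (u + v)) : P u := by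
  refine TensorProduct.induction_on (motive := P) u ?_ (fun p v => ?_) add
  · have := smul_const 0 0
    rwa [zero_smul] at this
  · rw [← HomLieConformal.smul_const]
    exact smul_const p v

@[elab_as_elim]
theorem VPoly.induction {n : ℕ} {P : VPoly n V → Prop} (u : VPoly n V)
    (const : ∀ v, P (const n v)) (smul : ∀ (q : Lam n) u, P u → P (q • u))
    (add : ∀ u v, P u → P v → P (u + v)) : P u :=
  VPoly.induction_smul_const u (fun p v => smul p _ (const v)) add

@[simp]
theorem extend_const {n : ℕ} (φ : V →ₗ[ℂ] VPoly n W) (v : V) : extend φ (const n v) = φ v := by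
  refine (LinearMap.liftBaseChange_tmul (Lam n) φ 1 v).trans ?_
  exact one_smul _ _

@[simp]
theorem subst_const {k n : ℕ} (t : Fin k → Lam n) (v : V) : subst t (const k v) = const n v := by
  change (MvPolynomial.aeval t (1 : Lam k)) ⊗ₜ[ℂ] v = (1 : Lam n) ⊗ₜ[ℂ] v
  rw [map_one]

@[simp]
theorem subst_smul {k n : ℕ} (t : Fin k → Lam n) (q : Lam k) (u : VPoly k V) :
    subst t (q • u) = MvPolynomial.aeval t q • subst t u := by
  have key (p : Lam k) (v : V) :
      subst t (p • const k v) = MvPolynomial.aeval t p • const n v := by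
    rw [smul_const, smul_const]
    rfl
  induction u using VPoly.induction_smul_const with
  | smul_const p v => rw [smul_smul, key, key, map_mul, mul_smul]
  | add u v hu hv => simp only [smul_add, map_add, hu, hv]

@[simp]
theorem mapCoeff_const {n : ℕ} (φ : V →ₗ[ℂ] W) (v : V) :
    mapCoeff n φ (const n v) = const n (φ v) := rfl

@[simp]
theorem mapCoeff_smul {n : ℕ} (φ : V →ₗ[ℂ] W) (q : Lam n) (u : VPoly n V) :
    mapCoeff n φ (q • u) = q • mapCoeff n φ u :=
  (φ.baseChange (Lam n)).map_smul q u

theorem subst_subst {k m n : ℕ} (t : Fin m → Lam n) (r : Fin k → Lam m) (u : VPoly k V) :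
    subst t (subst r u) = subst (fun i => MvPolynomial.aeval t (r i)) u := by
  induction u using VPoly.induction with
  | const v => simp
  | smul q u hu =>
    rw [subst_smul, subst_smul, subst_smul, hu, ← MvPolynomial.comp_aeval_apply]
  | add u v hu hv => simp only [map_add, hu, hv]

theorem subst_X {n : ℕ} (u : VPoly n V) : subst (fun i => (MvPolynomial.X i : Lam n)) u = u := by
  induction u using VPoly.induction with
  | const v => simp
  | smul q u hu => rw [subst_smul, hu]; congr 1; exact MvPolynomial.aeval_X_left_apply q
  | add u v hu hv => simp only [map_add, hu, hv]

theorem subst_mapCoeff {k n : ℕ} (t : Fin k → Lam n) (φ : V →ₗ[ℂ] W) (u : VPoly k V) :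
    subst t (mapCoeff k φ u) = mapCoeff n φ (subst t u) := by
  induction u using VPoly.induction with
  | const v => simp
  | smul q u hu => simp [hu]
  | add u v hu hv => simp only [map_add, hu, hv]

theorem mapCoeff_mapCoeff {n : ℕ} (φ : V →ₗ[ℂ] W) (ψ : A →ₗ[ℂ] V) (u : VPoly n A) :
    mapCoeff n φ (mapCoeff n ψ u) = mapCoeff n (φ ∘ₗ ψ) u := by
  induction u using VPoly.induction with
  | const v => simp
  | smul q u hu => simp [hu]
  | add u v hu hv => simp only [map_add, hu, hv]

@[simp]
theorem mapCoeff_zero {n : ℕ} (u : VPoly n V) : mapCoeff n (0 : V →ₗ[ℂ] W) u = 0 := by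
  induction u using VPoly.induction with
  | const v => simp
  | smul q u hu => simp [hu]
  | add u v hu hv => simp only [map_add, hu, hv, add_zero]

@[simp]
theorem mapCoeff_id {n : ℕ} (u : VPoly n V) : mapCoeff n (LinearMap.id : V →ₗ[ℂ] V) u = u := by
  induction u using VPoly.induction with
  | const v => simp
  | smul q u hu => simp [hu]
  | add u v hu hv => simp only [map_add, hu, hv]

theorem subst_extend {m n : ℕ} (t : Fin m → Lam n) (φ : V →ₗ[ℂ] VPoly m W) (u : VPoly m V) :
    subst t (extend φ u) = extend (subst t ∘ₗ φ) (subst t u) := by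
  induction u using VPoly.induction with
  | const v => simp
  | smul q u hu => simp [hu]
  | add u v hu hv => simp only [map_add, hu, hv]

theorem mapCoeff_extend {n : ℕ} (φ : W →ₗ[ℂ] A) (ψ : V →ₗ[ℂ] VPoly n W) (u : VPoly n V) :
    mapCoeff n φ (extend ψ u) = extend (mapCoeff n φ ∘ₗ ψ) u := by
  induction u using VPoly.induction with
  | const v => simp
  | smul q u hu => simp [hu]
  | add u v hu hv => simp only [map_add, hu, hv]

theorem extend_mapCoeff {n : ℕ} (φ : W →ₗ[ℂ] VPoly n A) (ψ : V →ₗ[ℂ] W) (u : VPoly n V) :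
    extend φ (mapCoeff n ψ u) = extend (φ ∘ₗ ψ) u := by
  induction u using VPoly.induction with
  | const v => simp
  | smul q u hu => simp [hu]
  | add u v hu hv => simp only [map_add, hu, hv]

theorem lamApply_eq_extend {n : ℕ} (b : A →ₗ[ℂ] V →ₗ[ℂ] VPoly 1 W) (c : Lam n) (a : A)
    (u : VPoly n V) : lamApply b c a u = extend (subst (fun _ => c) ∘ₗ b a) u := rfl

end Polynomials

/-! ### The submodule `(s + ∂) V[λ₁, …, λₙ]` and the substitution `λ†` -/

section Killed

variable {A V W : Type*} [AddCommGroup A] [Module ℂ A] [AddCommGroup V] [Module ℂ V]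
  [AddCommGroup W] [Module ℂ W]

/-- The submodule `(s + ∂) V[λ₁, …, λₙ]` of `V[λ₁, …, λₙ]`; modulo it, `∂` is multiplication
by `-s`. -/
def killed {n : ℕ} (D : Module.End ℂ V) (s : Lam n) : Submodule (Lam n) (VPoly n V) where
  carrier := {w | ∃ u, w = s • u + mapCoeff n D u}
  zero_mem' := ⟨0, by simp⟩
  add_mem' := by
    rintro _ _ ⟨u, rfl⟩ ⟨v, rfl⟩
    exact ⟨u + v, by rw [map_add, smul_add]; abel⟩
  smul_mem' := by
    rintro q _ ⟨u, rfl⟩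
    exact ⟨q • u, by rw [mapCoeff_smul, smul_add, smul_comm]⟩

theorem mapCoeff_der_smodEq {n : ℕ} (D : Module.End ℂ V) (s : Lam n) (u : VPoly n V) :
    mapCoeff n D u ≡ -(s • u) [SMOD killed D s] :=
  SModEq.sub_mem.2 ⟨u, by rw [sub_neg_eq_add, add_comm]⟩

/-- The hypothesis says that `φ` maps `(s + ∂) v` into `S`, for constant polynomials `v`. -/
theorem extend_mem_of_mem_killed {n : ℕ} {D : Module.End ℂ V} {s : Lam n}
    {S : Submodule (Lam n) (VPoly n W)} {φ : V →ₗ[ℂ] VPoly n W}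
    (h : ∀ v, s • φ v + φ (D v) ∈ S) {u : VPoly n V} (hu : u ∈ killed D s) : extend φ u ∈ S := by
  obtain ⟨u, rfl⟩ := hu
  rw [map_add, map_smul, extend_mapCoeff]
  induction u using VPoly.induction with
  | const v => simpa using h v
  | smul q u hu =>
    rw [map_smul, map_smul, smul_comm, ← smul_add]
    exact S.smul_mem _ hu
  | add u v hu hv =>
    rw [map_add, map_add, smul_add, add_add_add_comm]
    exact S.add_mem hu hv

theorem extend_smodEq_extend {n : ℕ} {S : Submodule (Lam n) (VPoly n W)} {φ ψ : V →ₗ[ℂ] VPoly n W}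
    (h : ∀ v, φ v ≡ ψ v [SMOD S]) (u : VPoly n V) : extend φ u ≡ extend ψ u [SMOD S] := by
  induction u using VPoly.induction with
  | const v => simpa using h v
  | smul q u hu => simpa using hu.smul q
  | add u v hu hv => simpa using hu.add hv

theorem extend_smodEq {n : ℕ} {D : Module.End ℂ V} {s : Lam n}
    {S : Submodule (Lam n) (VPoly n W)} {φ : V →ₗ[ℂ] VPoly n W}
    (h : ∀ v, s • φ v + φ (D v) ∈ S) {u v : VPoly n V} (huv : u ≡ v [SMOD killed D s]) :
    extend φ u ≡ extend φ v [SMOD S] := by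
  rw [SModEq.sub_mem, ← map_sub]
  exact extend_mem_of_mem_killed h (SModEq.sub_mem.1 huv)

theorem mapCoeff_smodEq {n : ℕ} {D : Module.End ℂ V} {D' : Module.End ℂ W} {φ : V →ₗ[ℂ] W}
    (h : ∀ v, φ (D v) = D' (φ v)) {s : Lam n} {u v : VPoly n V} (huv : u ≡ v [SMOD killed D s]) :
    mapCoeff n φ u ≡ mapCoeff n φ v [SMOD killed D' s] := by
  obtain ⟨w, hw⟩ := SModEq.sub_mem.1 huv
  refine SModEq.sub_mem.2 ⟨mapCoeff n φ w, ?_⟩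
  have hc : φ ∘ₗ D = D' ∘ₗ φ := LinearMap.ext h
  rw [← map_sub, hw, map_add, mapCoeff_smul, mapCoeff_mapCoeff, mapCoeff_mapCoeff, hc]

/-- The polynomial `q ⊗ r ∈ ℂ[λ₁, …, λₙ] ⊗ ℂ[∂]` applied to `v`, that is `q ⊗ r(∂) v`. -/
def evalDer (n : ℕ) (D : Module.End ℂ V) (v : V) : Lam n ⊗[ℂ] Polynomial ℂ →ₗ[ℂ] VPoly n V :=
  (LinearMap.applyₗ v ∘ₗ (Polynomial.aeval D).toLinearMap).lTensor (Lam n)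

theorem evalDer_tmul {n : ℕ} (D : Module.End ℂ V) (v : V) (q : Lam n) (r : Polynomial ℂ) :
    evalDer n D v (q ⊗ₜ r) = q • const n (Polynomial.aeval D r v) := by
  rw [smul_const]
  rfl

/-- The values of the variables in the substitution `dag`. -/
def dagVar (n : ℕ) : Fin (n + 1) → Lam n ⊗[ℂ] Polynomial ℂ :=
  Fin.snoc (fun i => MvPolynomial.X i ⊗ₜ[ℂ] (1 : Polynomial ℂ))
    (-(∑ i, MvPolynomial.X i) ⊗ₜ[ℂ] (1 : Polynomial ℂ) - 1 ⊗ₜ[ℂ] Polynomial.X)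

theorem dag_smul_const {n : ℕ} (D : Module.End ℂ V) (p : Lam (n + 1)) (v : V) :
    dag n D (p • const (n + 1) v) = evalDer n D v (MvPolynomial.aeval (dagVar n) p) := by
  rw [smul_const]
  change (LinearMap.lTensor (Lam n) (TensorProduct.lift
    (Polynomial.aeval D : Polynomial ℂ →ₐ[ℂ] Module.End ℂ V).toLinearMap))
    (TensorProduct.assoc ℂ (Lam n) (Polynomial ℂ) V
      ((MvPolynomial.aeval (dagVar n) p) ⊗ₜ v)) = _
  generalize MvPolynomial.aeval (dagVar n) p = z
  induction z using TensorProduct.induction_on with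
  | zero => rw [TensorProduct.zero_tmul, map_zero, map_zero, map_zero]; rfl
  | tmul q r => rfl
  | add x y hx hy => rw [TensorProduct.add_tmul, map_add, map_add, map_add, hx, hy]; rfl

theorem evalDer_mul_X {n : ℕ} (D : Module.End ℂ V) (v : V) (z : Lam n ⊗[ℂ] Polynomial ℂ) :
    evalDer n D v (z * (1 ⊗ₜ Polynomial.X)) = evalDer n D (D v) z := by
  induction z using TensorProduct.induction_on with
  | zero => simp
  | tmul q r =>
    rw [Algebra.TensorProduct.tmul_mul_tmul, evalDer_tmul, evalDer_tmul, mul_one, map_mul]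
    simp
  | add x y hx hy => simp only [add_mul, map_add, hx, hy]

/-- Modulo `s + ∂`, a polynomial in `∂` acts by its value at `-s`. -/
theorem aeval_der_smodEq {n : ℕ} (D : Module.End ℂ V) (s : Lam n) (r : Polynomial ℂ) (v : V) :
    const n (Polynomial.aeval D r v) ≡ Polynomial.aeval (-s) r • const n v [SMOD killed D s] := by
  induction r using Polynomial.induction_on' with
  | add p q hp hq => simpa [add_smul] using hp.add hq
  | monomial k a =>
    induction k generalizing v with
    | zero =>
      simp only [Polynomial.monomial_zero_left, Polynomial.aeval_C, Module.algebraMap_end_apply,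
        map_smul, algebraMap_smul]
      exact SModEq.rfl
    | succ k ih =>
      rw [← Polynomial.monomial_mul_X, map_mul, map_mul, Polynomial.aeval_X, Polynomial.aeval_X,
        Module.End.mul_apply]
      refine (ih (D v)).trans ?_
      rw [mul_smul]
      refine SModEq.smul ?_ _
      have := mapCoeff_der_smodEq D s (const n v)
      rwa [mapCoeff_const, ← neg_smul] at this

theorem subst_evalDer {n m : ℕ} (D : Module.End ℂ V) (t : Fin n → Lam m) (s : Lam m) (v : V)
    (z : Lam n ⊗[ℂ] Polynomial ℂ) :
    subst t (evalDer n D v z) ≡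
      Algebra.TensorProduct.lift (MvPolynomial.aeval t : Lam n →ₐ[ℂ] Lam m)
        (Polynomial.aeval (-s) : Polynomial ℂ →ₐ[ℂ] Lam m) (fun _ _ => Commute.all _ _) z •
        const m v [SMOD killed D s] := by
  induction z using TensorProduct.induction_on with
  | zero => simp
  | tmul q r =>
    rw [evalDer_tmul, subst_smul, subst_const, Algebra.TensorProduct.lift_tmul, mul_smul]
    exact (aeval_der_smodEq D s r v).smul _
  | add x y hx hy => simpa only [map_add, add_smul] using hx.add hy

/-- Modulo `s + ∂`, the substitution `λₙ₊₁†` followed by `λᵢ ↦ tᵢ` replaces `λₙ₊₁` by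
`s - t₁ - ⋯ - tₙ`. -/
theorem subst_dag_smodEq {n m : ℕ} (D : Module.End ℂ V) (t : Fin n → Lam m) (s : Lam m)
    (u : VPoly (n + 1) V) :
    subst t (dag n D u) ≡ subst (Fin.snoc t (s - ∑ i, t i) : Fin (n + 1) → Lam m) u
      [SMOD killed D s] := by
  induction u using VPoly.induction_smul_const with
  | smul_const p v =>
    rw [dag_smul_const]
    refine (subst_evalDer D t s v _).trans ?_
    rw [subst_smul, subst_const, MvPolynomial.comp_aeval_apply]
    have : (fun i => Algebra.TensorProduct.lift (MvPolynomial.aeval t : Lam n →ₐ[ℂ] Lam m)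
        (Polynomial.aeval (-s) : Polynomial ℂ →ₐ[ℂ] Lam m) (fun _ _ => Commute.all _ _)
        (dagVar n i)) = (Fin.snoc t (s - ∑ i, t i) : Fin (n + 1) → Lam m) := by
      funext i
      induction i using Fin.lastCases with
      | last => simp [dagVar]; ring
      | cast i => simp [dagVar]
    rw [this]
  | add u v hu hv => simpa only [map_add] using hu.add hv

/-- The substitution `λₙ₊₁†` is zero on the multiples of `λ₁ + ⋯ + λₙ₊₁ + ∂`. -/
theorem dag_eq_zero {n : ℕ} {D : Module.End ℂ V} {u : VPoly (n + 1) V}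
    (hu : u ∈ killed D (∑ i, MvPolynomial.X i : Lam (n + 1))) : dag n D u = 0 := by
  obtain ⟨u, rfl⟩ := hu
  induction u using VPoly.induction_smul_const with
  | smul_const p v =>
    rw [smul_smul, mapCoeff_smul, mapCoeff_const, map_add, dag_smul_const,
      dag_smul_const, map_mul, ← evalDer_mul_X, ← map_add, mul_comm, ← mul_add]
    have : MvPolynomial.aeval (dagVar n) (∑ i, MvPolynomial.X i : Lam (n + 1)) +
        1 ⊗ₜ Polynomial.X = 0 := by
      simp [dagVar, Fin.sum_univ_castSucc, TensorProduct.sum_tmul]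
      abel
    rw [this, mul_zero, map_zero]
  | add u v hu hv => rw [smul_add, map_add (mapCoeff (n + 1) D), add_add_add_comm, map_add, hu, hv, add_zero]

theorem dag_eq_of_smodEq {n : ℕ} {D : Module.End ℂ V} {u v : VPoly (n + 1) V}
    (h : u ≡ v [SMOD killed D (∑ i, MvPolynomial.X i : Lam (n + 1))]) : dag n D u = dag n D v := by
  rw [← sub_eq_zero, ← map_sub]
  exact dag_eq_zero (SModEq.sub_mem.1 h)

/-- The inclusion `V[λ₁, …, λₙ] → V[λ₁, …, λₙ₊₁]`. -/
def incl {n : ℕ} : VPoly n V →ₗ[ℂ] VPoly (n + 1) V :=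
  subst fun i => MvPolynomial.X i.castSucc

theorem incl_dag_smodEq {n : ℕ} (D : Module.End ℂ V) (u : VPoly (n + 1) V) :
    incl (dag n D u) ≡ u [SMOD killed D (∑ i, MvPolynomial.X i : Lam (n + 1))] := by
  have := subst_dag_smodEq D (fun i => MvPolynomial.X i.castSucc) (∑ i, MvPolynomial.X i) u
  rw [Fin.sum_univ_castSucc, add_sub_cancel_left] at this
  rw [Fin.sum_univ_castSucc]
  have hX : (Fin.snoc (fun i => MvPolynomial.X i.castSucc) (MvPolynomial.X (Fin.last n)) :
      Fin (n + 1) → Lam (n + 1)) = MvPolynomial.X := by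
    funext i
    induction i using Fin.lastCases <;> simp
  rw [hX] at this
  exact this.trans (by rw [subst_X])

@[simp]
theorem dag_incl {n : ℕ} (D : Module.End ℂ V) (u : VPoly n V) : dag n D (incl u) = u := by
  induction u using VPoly.induction_smul_const with
  | add u v hu hv => rw [map_add, map_add, hu, hv]
  | smul_const p v =>
  rw [incl, subst_smul, subst_const, dag_smul_const, MvPolynomial.comp_aeval_apply]
  have : MvPolynomial.aeval (fun i : Fin n =>
      MvPolynomial.aeval (dagVar n) (MvPolynomial.X i.castSucc : Lam (n + 1))) =
      (Algebra.TensorProduct.includeLeft : Lam n →ₐ[ℂ] Lam n ⊗[ℂ] Polynomial ℂ) := by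
    ext i
    simp [dagVar]
  rw [this, Algebra.TensorProduct.includeLeft_apply, evalDer_tmul]
  simp

/-- An identity in `V[λ₁, …, λₙ]` may be checked in `V[λ₁, …, λₙ₊₁]` modulo
`λ₁ + ⋯ + λₙ₊₁ + ∂`. -/
theorem eq_of_incl_smodEq {n : ℕ} (D : Module.End ℂ V) {u v : VPoly n V}
    (h : incl u ≡ incl v [SMOD killed D (∑ i, MvPolynomial.X i : Lam (n + 1))]) : u = v := by
  rw [← dag_incl D u, ← dag_incl D v, dag_eq_of_smodEq h]

/-- Modulo `s + ∂`, the polynomial `u(-c-∂)` is `u(d)` with `c + d = s`. -/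
theorem subst_opposite_smodEq {n : ℕ} (D : Module.End ℂ V) {c d s : Lam n} (h : c + d = s)
    (u : VPoly 1 V) :
    subst (fun _ => c) (opposite D u) ≡ subst (fun _ => d) u [SMOD killed D s] := by
  refine (subst_dag_smodEq D (fun _ => c) s _).trans ?_
  rw [subst_subst]
  convert SModEq.rfl using 3
  funext _
  rw [MvPolynomial.aeval_X]
  exact ((Fin.snoc_last (α := fun _ => Lam n) _ _).trans (by simp [← h])).symm

end Killed

/-! ### Sesquilinear brackets -/

section Brackets

variable {A V W : Type*} [AddCommGroup A] [Module ℂ A] [AddCommGroup V] [Module ℂ V]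
  [AddCommGroup W] [Module ℂ W]

theorem lamApply_sub_left {n : ℕ} (b b' : A →ₗ[ℂ] V →ₗ[ℂ] VPoly 1 W) (c : Lam n) (a : A)
    (u : VPoly n V) : lamApply (b - b') c a u = lamApply b c a u - lamApply b' c a u := by
  simp only [lamApply_eq_extend]
  induction u using VPoly.induction with
  | const v => simp
  | smul q u hu => simp only [map_smul, hu, smul_sub]
  | add u v hu hv => simp only [map_add, hu, hv]; abel

theorem lamApply_add_left {n : ℕ} (b b' : A →ₗ[ℂ] V →ₗ[ℂ] VPoly 1 W) (c : Lam n) (a : A)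
    (u : VPoly n V) : lamApply (b + b') c a u = lamApply b c a u + lamApply b' c a u := by
  simp only [lamApply_eq_extend]
  induction u using VPoly.induction with
  | const v => simp
  | smul q u hu => simp only [map_smul, hu, smul_add]
  | add u v hu hv => simp only [map_add, hu, hv]; abel

theorem subst_lamApply {m n : ℕ} (t : Fin m → Lam n) (b : A →ₗ[ℂ] V →ₗ[ℂ] VPoly 1 W) (c : Lam m)
    (a : A) (u : VPoly m V) :
    subst t (lamApply b c a u) = lamApply b (MvPolynomial.aeval t c) a (subst t u) := by
  rw [lamApply_eq_extend, lamApply_eq_extend, subst_extend]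
  congr 2
  ext v
  exact subst_subst _ _ _

/-- Sesquilinearity in the right argument: `a_c (s + ∂) = (s + c + ∂) a_c`. -/
theorem lamApply_smodEq {n : ℕ} {DV : Module.End ℂ V} {DW : Module.End ℂ W}
    {b : A →ₗ[ℂ] V →ₗ[ℂ] VPoly 1 W} {a : A}
    (hb : ∀ v, b a (DV v) = mapCoeff 1 DW (b a v) + (MvPolynomial.X 0 : Lam 1) • b a v)
    (c : Lam n) {r s : Lam n} (hs : r + c = s) {u v : VPoly n V} (h : u ≡ v [SMOD killed DV r]) :
    lamApply b c a u ≡ lamApply b c a v [SMOD killed DW s] := by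
  refine extend_smodEq (D := DV) (s := r) (fun v => ?_) h
  refine ⟨subst (fun _ => c) (b a v), ?_⟩
  simp only [LinearMap.comp_apply, hb, map_add, subst_mapCoeff, subst_smul, MvPolynomial.aeval_X,
    ← hs, add_smul]
  abel

theorem lamApply_opposite_smodEq {n : ℕ} (D : Module.End ℂ W) (b : A →ₗ[ℂ] V →ₗ[ℂ] VPoly 1 W)
    {c d s : Lam n} (h : c + d = s) (a : A) (u : VPoly n V) :
    lamApply (b.compr₂ (opposite D)) c a u ≡ lamApply b d a u [SMOD killed D s] :=
  extend_smodEq_extend (fun v => subst_opposite_smodEq D h (b a v)) u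

theorem lamApply_comp_flip {U : Type*} [AddCommGroup U] [Module ℂ U] {n : ℕ}
    (b : A →ₗ[ℂ] V →ₗ[ℂ] VPoly 1 W) (φ : U →ₗ[ℂ] A) (c : Lam n) (v : V) (u : VPoly n U) :
    lamApply (b ∘ₗ φ).flip c v u = lamApply b.flip c v (mapCoeff n φ u) := by
  rw [lamApply_eq_extend, lamApply_eq_extend, extend_mapCoeff]
  rfl

theorem lamApply_mapCoeff_opposite_smodEq {U : Type*} [AddCommGroup U] [Module ℂ U]
    {D : Module.End ℂ W} {D' : Module.End ℂ U} {φ : W →ₗ[ℂ] U} (hφ : ∀ w, φ (D w) = D' (φ w))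
    (b : A →ₗ[ℂ] V →ₗ[ℂ] VPoly 1 W) {n : ℕ} {c d s : Lam n} (h : c + d = s) (a : A)
    (u : VPoly n V) :
    lamApply (b.compr₂ (mapCoeff 1 φ ∘ₗ opposite D)) c a u ≡
      mapCoeff n φ (lamApply b d a u) [SMOD killed D' s] := by
  rw [lamApply_eq_extend, lamApply_eq_extend, mapCoeff_extend]
  refine extend_smodEq_extend (fun v => ?_) u
  change subst _ (mapCoeff 1 φ (opposite D (b a v))) ≡ mapCoeff n φ (subst _ (b a v)) [SMOD _]
  rw [subst_mapCoeff]
  exact mapCoeff_smodEq hφ (subst_opposite_smodEq D h _)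

theorem incl_opposite_smodEq (D : Module.End ℂ V) (u : VPoly 1 V) :
    incl (opposite D u) ≡ subst (fun _ => MvPolynomial.X 1) u
      [SMOD killed D (∑ i, MvPolynomial.X i : Lam 2)] :=
  incl_dag_smodEq D _

theorem opposite_eq_of_smodEq {D : Module.End ℂ V} {u v : VPoly 1 V}
    (h : subst (fun _ => MvPolynomial.X 1) u ≡ incl v
      [SMOD killed D (∑ i, MvPolynomial.X i : Lam 2)]) : opposite D u = v :=
  eq_of_incl_smodEq D ((incl_opposite_smodEq D u).trans h)

@[simp]
theorem opposite_opposite (D : Module.End ℂ V) (u : VPoly 1 V) :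
    opposite D (opposite D u) = u := by
  refine opposite_eq_of_smodEq ?_
  have := subst_opposite_smodEq D (add_comm (MvPolynomial.X 1 : Lam 2) (MvPolynomial.X 0)) u
  rw [Fin.sum_univ_two]
  refine this.trans ?_
  rw [incl]
  convert SModEq.rfl using 3
  funext i
  rw [Subsingleton.elim i 0]
  rfl

theorem mapCoeff_opposite {D : Module.End ℂ V} {D' : Module.End ℂ W} {φ : V →ₗ[ℂ] W}
    (h : ∀ v, φ (D v) = D' (φ v)) (u : VPoly 1 V) :
    mapCoeff 1 φ (opposite D u) = opposite D' (mapCoeff 1 φ u) := by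
  refine (opposite_eq_of_smodEq ?_).symm
  have := mapCoeff_smodEq h (incl_opposite_smodEq D u).symm
  rwa [← subst_mapCoeff, incl, ← subst_mapCoeff] at this

/-- The substitution `λ ↦ -λ-∂` turns multiplication by `λ` into that by `-λ-∂`. -/
theorem opposite_smul_X (D : Module.End ℂ V) (u : VPoly 1 V) :
    opposite D ((MvPolynomial.X 0 : Lam 1) • u) =
      -((MvPolynomial.X 0 : Lam 1) • opposite D u) - mapCoeff 1 D (opposite D u) := by
  refine opposite_eq_of_smodEq ?_
  have h₁ := (incl_opposite_smodEq D u).symm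
  have h₂ := mapCoeff_der_smodEq D (∑ i, MvPolynomial.X i : Lam 2) (incl (opposite D u))
  rw [subst_smul, MvPolynomial.aeval_X]
  refine (h₁.smul _).trans ?_
  rw [map_sub, map_neg]
  nth_rw 2 3 [incl]
  rw [subst_smul, subst_mapCoeff, MvPolynomial.aeval_X]
  refine (SModEq.trans (SModEq.sub (SModEq.refl _) h₂) ?_).symm
  rw [Fin.sum_univ_two, add_smul]
  change -((MvPolynomial.X 0 : Lam 2) • incl (opposite D u)) - _ ≡ _ [SMOD _]
  rw [sub_neg_eq_add, neg_add_cancel_left]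

end Brackets

section Identities

variable {A V : Type*} [AddCommGroup A] [Module ℂ A] [AddCommGroup V] [Module ℂ V]
  {DA α : Module.End ℂ A} {br : A →ₗ[ℂ] A →ₗ[ℂ] VPoly 1 A}
  {DV β : Module.End ℂ V} {ρ : A →ₗ[ℂ] V →ₗ[ℂ] VPoly 1 V}

/-- The Jacobi identity with `λ` and `μ` replaced by arbitrary polynomials. -/
theorem IsHomLieConformal.jacobi_subst (h : IsHomLieConformal DA α br) {n : ℕ} (c d : Lam n)
    (x y z : A) :
    lamApply br c (α x) (subst (fun _ => d) (br y z)) =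
      lamApply br.flip (c + d) (α z) (subst (fun _ => c) (br x y)) +
        lamApply br d (α y) (subst (fun _ => c) (br x z)) := by
  have := congrArg (subst ![c, d]) (h.jacobi x y z)
  simp only [map_add, subst_lamApply, subst_subst, MvPolynomial.aeval_X] at this
  exact this

theorem IsRepresentation.action_bracket_subst (h : IsRepresentation DA α br DV β ρ) {n : ℕ}
    (c d : Lam n) (x y : A) (v : V) :
    lamApply ρ.flip (c + d) (β v) (subst (fun _ => c) (br x y)) =
      lamApply ρ c (α x) (subst (fun _ => d) (ρ y v)) -
        lamApply ρ d (α y) (subst (fun _ => c) (ρ x v)) := by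
  have := congrArg (subst ![c, d]) (h.action_bracket x y v)
  simp only [map_add, map_sub, subst_lamApply, subst_subst, MvPolynomial.aeval_X] at this
  exact this

end Identities

/-! ### The sub-adjacent algebra and the induced action -/

section SubAdjacent

variable {L M : Type*} [AddCommGroup L] [Module ℂ L] [AddCommGroup M] [Module ℂ M]
  {DL αL : Module.End ℂ L} {br : L →ₗ[ℂ] L →ₗ[ℂ] VPoly 1 L}
  {DM βM : Module.End ℂ M} {ρ : L →ₗ[ℂ] M →ₗ[ℂ] VPoly 1 M} {T : M →ₗ[ℂ] L}

theorem subadjacentBracket_apply (m n : M) :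
    subadjacentBracket DM ρ T m n = ρ (T m) n - opposite DM (ρ (T n) m) := rfl

theorem inducedAction_apply (m : M) (x : L) :
    inducedAction br DM ρ T m x = br (T m) x + mapCoeff 1 T (opposite DM (ρ x m)) := rfl

theorem IsOOperator.mapCoeff_subadjacentBracket (hT : IsOOperator DL αL br DM βM ρ T) (m n : M) :
    mapCoeff 1 T (subadjacentBracket DM ρ T m n) = br (T m) (T n) :=
  (hT.bracket m n).symm

theorem subst_subadjacentBracket_smodEq {n : ℕ} {c d s : Lam n} (h : c + d = s) (x y : M) :
    subst (fun _ => c) (subadjacentBracket DM ρ T x y) ≡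
      subst (fun _ => c) (ρ (T x) y) - subst (fun _ => d) (ρ (T y) x) [SMOD killed DM s] := by
  rw [subadjacentBracket_apply, map_sub]
  exact SModEq.rfl.sub (subst_opposite_smodEq DM h _)

theorem lamApply_subadjacentBracket_smodEq {n : ℕ} {c d s : Lam n} (h : c + d = s) (x : M)
    (u : VPoly n M) :
    lamApply (subadjacentBracket DM ρ T) c x u ≡
      lamApply ρ c (T x) u - lamApply ρ.flip d x (mapCoeff n T u) [SMOD killed DM s] := by
  have := lamApply_opposite_smodEq DM (ρ ∘ₗ T).flip h x u
  rw [lamApply_comp_flip] at this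
  refine SModEq.trans ?_ (SModEq.rfl.sub this)
  rw [subadjacentBracket, commutatorBracket, preLieProduct, lamApply_sub_left]
  rfl

theorem lamApply_subadjacentBracket_flip_smodEq {n : ℕ} {c d s : Lam n} (h : c + d = s) (x : M)
    (u : VPoly n M) :
    lamApply (subadjacentBracket DM ρ T).flip c x u ≡
      lamApply ρ.flip c x (mapCoeff n T u) - lamApply ρ d (T x) u [SMOD killed DM s] := by
  refine SModEq.trans ?_ (SModEq.rfl.sub (lamApply_opposite_smodEq DM (ρ ∘ₗ T) h x u))
  have e : (subadjacentBracket DM ρ T).flip =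
      (ρ ∘ₗ T).flip - (ρ ∘ₗ T).compr₂ (opposite DM) := rfl
  rw [e, lamApply_sub_left, lamApply_comp_flip]

/-- `[βx_c [y_d z]ᶜ]ᶜ` in terms of the products `ρ(Tβ·) ρ(T·) ·`, where `z` carries the
variable `e`. -/
theorem lamApply_subadjacentBracket_subadjacentBracket
    (hρ : IsRepresentation DL αL br DM βM ρ) (hT : IsOOperator DL αL br DM βM ρ T)
    {n : ℕ} {c d e s : Lam n} (h : c + d + e = s) (x y z : M) :
    lamApply (subadjacentBracket DM ρ T) c (βM x)
        (subst (fun _ => d) (subadjacentBracket DM ρ T y z)) ≡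
      lamApply ρ c (αL (T x)) (subst (fun _ => d) (ρ (T y) z)) -
        lamApply ρ c (αL (T x)) (subst (fun _ => e) (ρ (T z) y)) -
        (lamApply ρ d (αL (T y)) (subst (fun _ => e) (ρ (T z) x)) -
          lamApply ρ e (αL (T z)) (subst (fun _ => d) (ρ (T y) x))) [SMOD killed DM s] := by
  refine (lamApply_subadjacentBracket_smodEq (d := d + e) (by rw [← h]; ring) _ _).trans ?_
  rw [← subst_mapCoeff, hT.mapCoeff_subadjacentBracket, hρ.action_bracket_subst, hT.map_twist,
    ← map_sub (lamApply ρ c (αL (T x)))]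
  exact (lamApply_smodEq (hρ.der_right _) c (by rw [← h]; ring)
    (subst_subadjacentBracket_smodEq rfl y z)).sub SModEq.rfl

/-- `[[x_c y]ᶜ_{c+d} βz]ᶜ` in terms of the products `ρ(Tβ·) ρ(T·) ·`, where `z` carries the
variable `e`. -/
theorem lamApply_subadjacentBracket_flip_subadjacentBracket
    (hρ : IsRepresentation DL αL br DM βM ρ) (hT : IsOOperator DL αL br DM βM ρ T)
    {n : ℕ} {c d e s : Lam n} (h : c + d + e = s) (x y z : M) :
    lamApply (subadjacentBracket DM ρ T).flip (c + d) (βM z)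
        (subst (fun _ => c) (subadjacentBracket DM ρ T x y)) ≡
      lamApply ρ c (αL (T x)) (subst (fun _ => d) (ρ (T y) z)) -
        lamApply ρ d (αL (T y)) (subst (fun _ => c) (ρ (T x) z)) -
        (lamApply ρ e (αL (T z)) (subst (fun _ => c) (ρ (T x) y)) -
          lamApply ρ e (αL (T z)) (subst (fun _ => d) (ρ (T y) x))) [SMOD killed DM s] := by
  refine (lamApply_subadjacentBracket_flip_smodEq h _ _).trans ?_
  rw [← subst_mapCoeff, hT.mapCoeff_subadjacentBracket, hρ.action_bracket_subst, hT.map_twist,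
    ← map_sub (lamApply ρ e (αL (T z)))]
  exact SModEq.rfl.sub (lamApply_smodEq (hρ.der_right _) e h
    (subst_subadjacentBracket_smodEq rfl x y))

theorem subadjacentBracket_der_left (hρ : IsRepresentation DL αL br DM βM ρ)
    (hT : IsOOperator DL αL br DM βM ρ T) (x y : M) :
    subadjacentBracket DM ρ T (DM x) y =
      -((MvPolynomial.X 0 : Lam 1) • subadjacentBracket DM ρ T x y) := by
  simp only [subadjacentBracket_apply, hT.map_der, hρ.der_left, hρ.der_right, map_add,
    opposite_smul_X, smul_sub, ← mapCoeff_opposite (φ := DM) (D' := DM) (D := DM) fun _ => rfl]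
  abel

theorem subadjacentBracket_der_right (hρ : IsRepresentation DL αL br DM βM ρ)
    (hT : IsOOperator DL αL br DM βM ρ T) (x y : M) :
    subadjacentBracket DM ρ T x (DM y) = mapCoeff 1 DM (subadjacentBracket DM ρ T x y) +
      (MvPolynomial.X 0 : Lam 1) • subadjacentBracket DM ρ T x y := by
  simp only [subadjacentBracket_apply, hT.map_der, hρ.der_left, hρ.der_right, map_sub, map_neg,
    opposite_smul_X, smul_sub]
  abel

theorem isHomLieConformal_subadjacentBracket (hρ : IsRepresentation DL αL br DM βM ρ)
    (hT : IsOOperator DL αL br DM βM ρ T) :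
    IsHomLieConformal DM βM (subadjacentBracket DM ρ T) where
  twist_der := hρ.twist_der
  der_left := subadjacentBracket_der_left hρ hT
  der_right := subadjacentBracket_der_right hρ hT
  skew x y := by simp [subadjacentBracket_apply]
  twist_bracket x y := by
    simp only [subadjacentBracket_apply, map_sub, hT.map_twist, ← hρ.twist_action,
      mapCoeff_opposite hρ.twist_der]
  jacobi x y z := by
    refine eq_of_incl_smodEq DM ?_
    have h : (MvPolynomial.X 0 + MvPolynomial.X 1 + MvPolynomial.X 2 : Lam 3) =
        ∑ i, MvPolynomial.X i := (Fin.sum_univ_three _).symm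
    have h' : (MvPolynomial.X 1 + MvPolynomial.X 0 + MvPolynomial.X 2 : Lam 3) =
        ∑ i, MvPolynomial.X i := by rw [← h]; ring
    have h₁ := lamApply_subadjacentBracket_subadjacentBracket hρ hT h x y z
    have h₂ := lamApply_subadjacentBracket_flip_subadjacentBracket hρ hT h x y z
    have h₃ := lamApply_subadjacentBracket_subadjacentBracket hρ hT h' y x z
    simp only [incl, map_add, subst_lamApply, subst_subst, MvPolynomial.aeval_X]
    refine h₁.trans (SModEq.trans ?_ (h₂.add h₃).symm)
    convert SModEq.rfl using 1
    abel

theorem subst_inducedAction_smodEq (hT : IsOOperator DL αL br DM βM ρ T) {n : ℕ} {c d s : Lam n}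
    (h : c + d = s) (m : M) (x : L) :
    subst (fun _ => c) (inducedAction br DM ρ T m x) ≡
      subst (fun _ => c) (br (T m) x) + mapCoeff n T (subst (fun _ => d) (ρ x m))
        [SMOD killed DL s] := by
  rw [inducedAction_apply, map_add, subst_mapCoeff]
  exact SModEq.rfl.add (mapCoeff_smodEq hT.map_der (subst_opposite_smodEq DM h _))

theorem lamApply_inducedAction_smodEq (hT : IsOOperator DL αL br DM βM ρ T) {n : ℕ} {c d s : Lam n}
    (h : c + d = s) (m : M) (u : VPoly n L) :
    lamApply (inducedAction br DM ρ T) c m u ≡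
      lamApply br c (T m) u + mapCoeff n T (lamApply ρ.flip d m u) [SMOD killed DL s] := by
  rw [inducedAction, lamApply_add_left]
  exact SModEq.rfl.add (lamApply_mapCoeff_opposite_smodEq hT.map_der ρ.flip h m u)

theorem lamApply_inducedAction_flip_smodEq (hT : IsOOperator DL αL br DM βM ρ T) {n : ℕ}
    {c d s : Lam n} (h : c + d = s) (x : L) (u : VPoly n M) :
    lamApply (inducedAction br DM ρ T).flip c x u ≡
      lamApply br.flip c x (mapCoeff n T u) + mapCoeff n T (lamApply ρ d x u)
        [SMOD killed DL s] := by
  have e : (inducedAction br DM ρ T).flip =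
      (br ∘ₗ T).flip + ρ.compr₂ (mapCoeff 1 T ∘ₗ opposite DM) := rfl
  rw [e, lamApply_add_left, lamApply_comp_flip]
  exact SModEq.rfl.add (lamApply_mapCoeff_opposite_smodEq hT.map_der ρ h x u)

/-- The defining identity of an `𝒪`-operator, with a polynomial as second argument. -/
theorem IsOOperator.lamApply_mapCoeff_smodEq (hT : IsOOperator DL αL br DM βM ρ T) {n : ℕ}
    {c d s : Lam n} (h : c + d = s) (m : M) (u : VPoly n M) :
    lamApply br c (T m) (mapCoeff n T u) ≡
      mapCoeff n T (lamApply ρ c (T m) u) - mapCoeff n T (lamApply ρ.flip d m (mapCoeff n T u))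
        [SMOD killed DL s] := by
  rw [← map_sub]
  refine SModEq.trans ?_ (mapCoeff_smodEq hT.map_der (lamApply_subadjacentBracket_smodEq h m u))
  rw [lamApply_eq_extend, lamApply_eq_extend, extend_mapCoeff, mapCoeff_extend]
  refine extend_smodEq_extend (fun v => ?_) u
  simp only [LinearMap.comp_apply, ← subst_mapCoeff, hT.mapCoeff_subadjacentBracket]
  exact SModEq.rfl

theorem inducedAction_der_right (hL : IsHomLieConformal DL αL br)
    (hρ : IsRepresentation DL αL br DM βM ρ) (hT : IsOOperator DL αL br DM βM ρ T) (m : M) (x : L) :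
    inducedAction br DM ρ T m (DL x) = mapCoeff 1 DL (inducedAction br DM ρ T m x) +
      (MvPolynomial.X 0 : Lam 1) • inducedAction br DM ρ T m x := by
  have hc (u : VPoly 1 M) : mapCoeff 1 T (mapCoeff 1 DM u) = mapCoeff 1 DL (mapCoeff 1 T u) := by
    rw [mapCoeff_mapCoeff, mapCoeff_mapCoeff,
      LinearMap.ext hT.map_der (f := T ∘ₗ DM) (g := DL ∘ₗ T)]
  simp only [inducedAction_apply, hL.der_right, hρ.der_left, map_add, map_neg, map_sub,
    opposite_smul_X, mapCoeff_smul, smul_add, hc]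
  abel

/-- `ρ_T(βx)_c ρ_T(y)_d z`, where `z` carries the variable `e`. -/
theorem lamApply_inducedAction_inducedAction (hL : IsHomLieConformal DL αL br)
    (hρ : IsRepresentation DL αL br DM βM ρ) (hT : IsOOperator DL αL br DM βM ρ T)
    {n : ℕ} {c d e s : Lam n} (h : c + d + e = s) (x y : M) (z : L) :
    lamApply (inducedAction br DM ρ T) c (βM x)
        (subst (fun _ => d) (inducedAction br DM ρ T y z)) ≡
      lamApply br c (αL (T x)) (subst (fun _ => d) (br (T y) z)) +
        mapCoeff n T (lamApply ρ c (αL (T x)) (subst (fun _ => e) (ρ z y)) +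
          (lamApply ρ d (αL (T y)) (subst (fun _ => e) (ρ z x)) -
            lamApply ρ e (αL z) (subst (fun _ => d) (ρ (T y) x)))) [SMOD killed DL s] := by
  have h₀ : c + (d + e) = s := by rw [← h]; ring
  refine (lamApply_smodEq (inducedAction_der_right hL hρ hT _) c (by rw [← h]; ring)
    (subst_inducedAction_smodEq hT (rfl : d + e = d + e) y z)).trans ?_
  refine (lamApply_inducedAction_smodEq hT h₀ _ _).trans ?_
  rw [map_add, map_add (lamApply ρ.flip _ _), hρ.action_bracket_subst]
  -- The term `T ρ(T ρ(z) y) βx` of the `𝒪`-operator identity cancels against the one from `ρ_T(βx)`.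
  refine ((SModEq.rfl.add (hT.lamApply_mapCoeff_smodEq h₀ _ _)).add SModEq.rfl).trans ?_
  simp only [map_add, map_sub, hT.map_twist]
  convert SModEq.rfl using 1
  abel

theorem isRepresentation_inducedAction (hL : IsHomLieConformal DL αL br)
    (hρ : IsRepresentation DL αL br DM βM ρ) (hT : IsOOperator DL αL br DM βM ρ T) :
    IsRepresentation DM βM (subadjacentBracket DM ρ T) DL αL (inducedAction br DM ρ T) where
  twist_der := hL.twist_der
  der_left m x := by
    have hc : opposite DM (mapCoeff 1 DM (ρ x m)) = mapCoeff 1 DM (opposite DM (ρ x m)) :=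
      (mapCoeff_opposite (fun _ => rfl) _).symm
    simp only [inducedAction_apply, hT.map_der, hL.der_left, hρ.der_right, map_add, map_sub,
      map_neg, opposite_smul_X, mapCoeff_smul, smul_add, hc]
    abel
  der_right := inducedAction_der_right hL hρ hT
  twist_action m x := by
    have hc : αL ∘ₗ T = T ∘ₗ βM := LinearMap.ext fun m => (hT.map_twist m).symm
    simp only [inducedAction_apply, map_add, hL.twist_bracket, hT.map_twist, mapCoeff_mapCoeff, hc]
    rw [← mapCoeff_mapCoeff, mapCoeff_opposite hρ.twist_der, hρ.twist_action]
  action_bracket x y z := by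
    refine eq_of_incl_smodEq DL ?_
    have h : (MvPolynomial.X 0 + MvPolynomial.X 1 + MvPolynomial.X 2 : Lam 3) =
        ∑ i, MvPolynomial.X i := (Fin.sum_univ_three _).symm
    have h' : (MvPolynomial.X 1 + MvPolynomial.X 0 + MvPolynomial.X 2 : Lam 3) =
        ∑ i, MvPolynomial.X i := by rw [← h]; ring
    have h₁ := lamApply_inducedAction_inducedAction hL hρ hT h x y z
    have h₂ := lamApply_inducedAction_inducedAction hL hρ hT h' y x z
    have h₃ : mapCoeff 3 T (lamApply ρ (MvPolynomial.X 2) (αL z)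
        (subst (fun _ => MvPolynomial.X 0) (subadjacentBracket DM ρ T x y))) ≡ _
        [SMOD killed DL (∑ i, MvPolynomial.X i : Lam 3)] :=
      mapCoeff_smodEq hT.map_der (lamApply_smodEq (hρ.der_right _) _ h
        (subst_subadjacentBracket_smodEq rfl x y))
    simp only [incl, map_add, map_sub, subst_lamApply, subst_subst, MvPolynomial.aeval_X]
    refine ((lamApply_inducedAction_flip_smodEq hT h _ _).trans (SModEq.rfl.add h₃)).trans
      (SModEq.trans ?_ (h₁.sub h₂).symm)
    rw [← subst_mapCoeff, hT.mapCoeff_subadjacentBracket]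
    have hj := hL.jacobi_subst (MvPolynomial.X 0 : Lam 3) (MvPolynomial.X 1) (T x) (T y) z
    change lamApply br.flip (MvPolynomial.X 0 + MvPolynomial.X 1) (αL z)
      (subst (fun _ => MvPolynomial.X 0) (br (T x) (T y))) + _ ≡ _ [SMOD _]
    change _ ≡ lamApply br (MvPolynomial.X 0) (αL (T x))
      (subst (fun _ => MvPolynomial.X 1) (br (T y) z)) + _ - _ [SMOD _]
    rw [hj]
    simp only [map_add, map_sub]
    convert SModEq.rfl using 1
    abel

end SubAdjacent

/-! ### Cochains with arbitrary polynomials as subscripts -/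

section Evaluation

variable {A V W : Type*} [AddCommGroup A] [Module ℂ A] [AddCommGroup V] [Module ℂ V]
  [AddCommGroup W] [Module ℂ W]

theorem mapCoeff_dag {n : ℕ} {D : Module.End ℂ V} {D' : Module.End ℂ W} {φ : V →ₗ[ℂ] W}
    (h : ∀ v, φ (D v) = D' (φ v)) (u : VPoly (n + 1) V) :
    mapCoeff n φ (dag n D u) = dag n D' (mapCoeff (n + 1) φ u) := by
  refine eq_of_incl_smodEq D' ?_
  rw [incl, subst_mapCoeff]
  exact (mapCoeff_smodEq h (incl_dag_smodEq D u)).trans (incl_dag_smodEq D' _).symm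

theorem dag_smul_X_castSucc {n : ℕ} (D : Module.End ℂ V) (i : Fin n) (u : VPoly (n + 1) V) :
    dag n D ((MvPolynomial.X i.castSucc : Lam (n + 1)) • u) =
      (MvPolynomial.X i : Lam n) • dag n D u := by
  refine eq_of_incl_smodEq D ((incl_dag_smodEq D _).trans ?_)
  rw [incl, subst_smul, MvPolynomial.aeval_X]
  exact (incl_dag_smodEq D u).symm.smul _

theorem dag_smul_X_last {n : ℕ} (D : Module.End ℂ V) (u : VPoly (n + 1) V) :
    dag n D ((MvPolynomial.X (Fin.last n) : Lam (n + 1)) • u) =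
      -(mapCoeff n D (dag n D u) + (∑ i, MvPolynomial.X i : Lam n) • dag n D u) := by
  refine eq_of_incl_smodEq D ((incl_dag_smodEq D _).trans ?_)
  rw [incl, map_neg, map_add, subst_smul, subst_mapCoeff, map_sum]
  simp only [MvPolynomial.aeval_X]
  have h₁ := (mapCoeff_der_smodEq D (∑ i, MvPolynomial.X i : Lam (n + 1)) (incl (dag n D u)))
  refine ((incl_dag_smodEq D u).symm.smul _).trans
    (SModEq.trans ?_ (SModEq.neg (h₁.add SModEq.rfl)).symm)
  rw [Fin.sum_univ_castSucc, add_smul]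
  convert SModEq.rfl using 1
  simp only [incl]
  abel

/-- The value `f_{c₁,…,cₖ}(x₁, …, xₖ₊₁)` at polynomials `c₁, …, cₖ₊₁`, the last of which
is not used. -/
def evalAt {k n : ℕ} (f : PreCochain k A V) (c : Fin (k + 1) → Lam n) (x : Fin (k + 1) → A) :
    VPoly n V :=
  subst (fun i => c i.castSucc) (f x)

theorem subst_evalAt {k m n : ℕ} (t : Fin m → Lam n) (f : PreCochain k A V)
    (c : Fin (k + 1) → Lam m) (x : Fin (k + 1) → A) :
    subst t (evalAt f c x) = evalAt f (fun i => MvPolynomial.aeval t (c i)) x :=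
  subst_subst _ _ _

variable {DA α : Module.End ℂ A} {DV β : Module.End ℂ V}

theorem IsCochain.mapCoeff_evalAt {k n : ℕ} {f : PreCochain k A V} (hf : IsCochain DA α DV β f)
    (c : Fin (k + 1) → Lam n) (x : Fin (k + 1) → A) :
    mapCoeff n β (evalAt f c x) = evalAt f c fun i => α (x i) := by
  rw [evalAt, ← subst_mapCoeff, hf.twist]
  rfl

/-- Modulo `c₁ + ⋯ + cₖ₊₁ + ∂`, sesquilinearity takes the same form in all the arguments. -/
theorem IsCochain.evalAt_der {k n : ℕ} {f : PreCochain k A V} (hf : IsCochain DA α DV β f)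
    (c : Fin (k + 1) → Lam n) (x : Fin (k + 1) → A) (i : Fin (k + 1)) :
    evalAt f c (Function.update x i (DA (x i))) ≡ -(c i • evalAt f c x)
      [SMOD killed DV (∑ i, c i)] := by
  induction i using Fin.lastCases with
  | cast i => simp [evalAt, hf.der]
  | last =>
    rw [evalAt, hf.der_last, map_add, subst_mapCoeff, subst_smul, map_sum]
    simp only [MvPolynomial.aeval_X]
    refine ((mapCoeff_der_smodEq DV (∑ i, c i) _).add SModEq.rfl).trans ?_
    rw [Fin.sum_univ_castSucc, add_smul]
    convert SModEq.rfl using 1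
    simp only [evalAt]
    abel

/-- Modulo `c₁ + ⋯ + cₖ₊₁ + ∂`, skew-symmetry is plain skew-symmetry in the pairs
`(cᵢ, xᵢ)`. -/
theorem IsCochain.evalAt_perm {k n : ℕ} {f : PreCochain k A V} (hf : IsCochain DA α DV β f)
    (c : Fin (k + 1) → Lam n) (x : Fin (k + 1) → A) (τ : Equiv.Perm (Fin (k + 1))) :
    evalAt f c x ≡ (Equiv.Perm.sign τ : ℤ) • evalAt f (c ∘ τ) (x ∘ τ)
      [SMOD killed DV (∑ i, c i)] := by
  rw [evalAt, hf.skew τ x, map_zsmul]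
  refine SModEq.zsmul ((subst_dag_smodEq DV _ (∑ i, c i) _).trans ?_) _
  have hc : (Fin.snoc (fun i => c i.castSucc) (∑ i, c i - ∑ i : Fin k, c i.castSucc) :
      Fin (k + 1) → Lam n) = c := by
    funext i
    rw [Fin.sum_univ_castSucc, add_sub_cancel_left]
    induction i using Fin.lastCases <;> simp
  rw [hc, subst_subst]
  simp only [MvPolynomial.aeval_X]
  exact SModEq.rfl

/-- A cochain may be given by a polynomial in `λ₁, …, λₖ₊₁`, with sesquilinearity and
skew-symmetry in their symmetric form. -/
theorem IsCochain.of_dag {k : ℕ} {f : PreCochain k A V} (C : (Fin (k + 1) → A) → VPoly (k + 1) V)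
    (hC : ∀ x, f x = dag k DV (C x)) (twist : ∀ x, mapCoeff k β (f x) = f (fun i => α (x i)))
    (der : ∀ x i, C (Function.update x i (DA (x i))) ≡ -((MvPolynomial.X i : Lam (k + 1)) • C x)
      [SMOD killed DV (∑ i, MvPolynomial.X i : Lam (k + 1))])
    (skew : ∀ (τ : Equiv.Perm (Fin (k + 1))) x, C x ≡ (Equiv.Perm.sign τ : ℤ) •
      subst (fun i => (MvPolynomial.X (τ i) : Lam (k + 1))) (C (x ∘ τ))
        [SMOD killed DV (∑ i, MvPolynomial.X i : Lam (k + 1))]) :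
    IsCochain DA α DV β f where
  twist := twist
  der x i := by rw [hC, hC, dag_eq_of_smodEq (der x i.castSucc), map_neg, dag_smul_X_castSucc]
  der_last x := by
    rw [hC, hC, dag_eq_of_smodEq (der x (Fin.last k)), map_neg, dag_smul_X_last, neg_neg]
  skew τ x := by
    rw [hC, hC, dag_eq_of_smodEq (skew τ x), map_zsmul]
    congr 1
    refine dag_eq_of_smodEq (SModEq.symm ?_)
    refine (subst_dag_smodEq DV (fun i : Fin k => MvPolynomial.X (τ i.castSucc))
      (∑ i, MvPolynomial.X i : Lam (k + 1)) _).trans ?_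
    have hτ : (Fin.snoc (fun i : Fin k => MvPolynomial.X (τ i.castSucc))
        (∑ i, MvPolynomial.X i - ∑ i : Fin k, MvPolynomial.X (τ i.castSucc)) :
        Fin (k + 1) → Lam (k + 1)) = fun i => MvPolynomial.X (τ i) := by
      funext i
      rw [← Equiv.sum_comp τ, Fin.sum_univ_castSucc, add_sub_cancel_left]
      induction i using Fin.lastCases <;> simp
    rw [hτ]
    exact SModEq.rfl

/-- The value `f_{s,c₁,…,cₖ}(u, y₁, …, yₖ)` at a polynomial `u`; the last of `s, c₁, …, cₖ`
is not used. -/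
def insertAt {k n : ℕ} (f : PreCochain k A V) (s : Lam n) (c : Fin k → Lam n) (y : Fin k → A) :
    VPoly n A →ₗ[Lam n] VPoly n V :=
  extend (subst (fun j => (Fin.cons s c : Fin (k + 1) → Lam n) j.castSucc) ∘ₗ firstArgument f y)

theorem insertAt_const {k n : ℕ} (f : PreCochain k A V) (s : Lam n) (c : Fin k → Lam n)
    (y : Fin k → A) (a : A) :
    insertAt f s c y (const n a) = evalAt f (Fin.cons s c) (Fin.cons a y) :=
  extend_const _ _

theorem subst_insertAt {k m n : ℕ} (t : Fin m → Lam n) (f : PreCochain k A V) (s : Lam m)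
    (c : Fin k → Lam m) (y : Fin k → A) (u : VPoly m A) :
    subst t (insertAt f s c y u) = insertAt f (MvPolynomial.aeval t s)
      (fun j => MvPolynomial.aeval t (c j)) y (subst t u) := by
  rw [insertAt, insertAt, subst_extend]
  congr 2
  ext a
  refine (subst_evalAt t f (Fin.cons s c) (Fin.cons a y)).trans ?_
  change evalAt f _ _ = evalAt f _ _
  congr 1
  funext i
  induction i using Fin.cases <;> rfl

theorem IsCochain.mapCoeff_insertAt {k n : ℕ} {f : PreCochain k A V}
    (hf : IsCochain DA α DV β f) (s : Lam n) (c : Fin k → Lam n) (y : Fin k → A) (u : VPoly n A) :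
    mapCoeff n β (insertAt f s c y u) = insertAt f s c (fun j => α (y j)) (mapCoeff n α u) := by
  rw [insertAt, insertAt, mapCoeff_extend, extend_mapCoeff]
  congr 2
  ext a
  refine (hf.mapCoeff_evalAt (Fin.cons s c) (Fin.cons a y)).trans ?_
  change evalAt f _ _ = evalAt f _ _
  congr 1
  funext i
  induction i using Fin.cases <;> rfl

theorem sum_cons {n k : ℕ} (s : Lam n) (c : Fin k → Lam n) :
    ∑ i, (Fin.cons s c : Fin (k + 1) → Lam n) i = s + ∑ j, c j := by
  rw [Fin.sum_univ_succ]
  simp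

/-- Sesquilinearity in the first argument, at a polynomial. -/
theorem IsCochain.insertAt_smodEq {k n : ℕ} {f : PreCochain k A V} (hf : IsCochain DA α DV β f)
    (s : Lam n) (c : Fin k → Lam n) (y : Fin k → A) {u v : VPoly n A}
    (h : u ≡ v [SMOD killed DA s]) :
    insertAt f s c y u ≡ insertAt f s c y v [SMOD killed DV (s + ∑ j, c j)] := by
  refine extend_smodEq (D := DA) (s := s) (fun a => ?_) h
  have := hf.evalAt_der (Fin.cons s c) (Fin.cons a y) 0
  rw [Fin.cons_zero, Fin.cons_zero, Fin.update_cons_zero, SModEq.sub_mem, sub_neg_eq_add,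
    add_comm (evalAt _ _ _), sum_cons s c] at this
  exact this

theorem IsCochain.insertAt_der {k n : ℕ} {f : PreCochain k A V} (hf : IsCochain DA α DV β f)
    (s : Lam n) (c : Fin k → Lam n) (y : Fin k → A) (j : Fin k) (u : VPoly n A) :
    insertAt f s c (Function.update y j (DA (y j))) u ≡ -(c j • insertAt f s c y u)
      [SMOD killed DV (s + ∑ j, c j)] := by
  induction u using VPoly.induction with
  | const a =>
    have := hf.evalAt_der (Fin.cons s c) (Fin.cons a y) j.succ
    rw [Fin.cons_succ, Fin.cons_succ, ← Fin.cons_update, sum_cons s c] at this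
    rwa [insertAt_const, insertAt_const]
  | smul q u hu =>
    rw [map_smul, map_smul, smul_comm, ← smul_neg]
    exact hu.smul q
  | add u v hu hv =>
    rw [map_add, map_add, smul_add, neg_add]
    exact hu.add hv

theorem cons_comp_decomposeFin_symm {B : Type*} {k : ℕ} (b : B) (z : Fin k → B)
    (σ : Equiv.Perm (Fin k)) : (Fin.cons b z : Fin (k + 1) → B) ∘
      (Equiv.Perm.decomposeFin.symm (0, σ)) = Fin.cons b (z ∘ σ) := by
  funext i
  induction i using Fin.cases <;> simp

/-- Skew-symmetry in the arguments after the first, at a polynomial. -/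
theorem IsCochain.insertAt_perm {k n : ℕ} {f : PreCochain k A V} (hf : IsCochain DA α DV β f)
    (s : Lam n) (c : Fin k → Lam n) (y : Fin k → A) (σ : Equiv.Perm (Fin k)) (u : VPoly n A) :
    insertAt f s c y u ≡ (Equiv.Perm.sign σ : ℤ) • insertAt f s (c ∘ σ) (y ∘ σ) u
      [SMOD killed DV (s + ∑ j, c j)] := by
  induction u using VPoly.induction with
  | const a =>
    have := hf.evalAt_perm (Fin.cons s c) (Fin.cons a y) (Equiv.Perm.decomposeFin.symm (0, σ))
    rw [Equiv.Perm.decomposeFin.symm_sign, if_pos rfl, one_mul, sum_cons s c] at this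
    rw [cons_comp_decomposeFin_symm, cons_comp_decomposeFin_symm] at this
    rwa [insertAt_const, insertAt_const]
  | smul q u hu =>
    rw [map_smul, map_smul, smul_comm]
    exact hu.smul q
  | add u v hu hv =>
    rw [map_add, map_add, smul_add]
    exact hu.add hv

end Evaluation

/-! ### Shuffles -/

section Shuffles

variable {k l N : ℕ} (h : k + l = N)

theorem isShuffle_iff (τ : Equiv.Perm (Fin (N + 1))) :
    IsShuffle (l + 1) τ ↔
      StrictMono (fun i => τ (headPos h i)) ∧ StrictMono (fun j => τ (tailPos h j)) := by
  constructor
  · intro hτ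
    refine ⟨fun i j hij => hτ _ _ hij (Or.inl j.2), fun i j hij => hτ _ _ ?_ (Or.inr ?_)⟩
    · simpa [tailPos] using hij
    · simp [tailPos]
  · rintro ⟨h₁, h₂⟩ i j hij (hj | hi)
    · exact h₁ (a := ⟨i, by omega⟩) (b := ⟨j, hj⟩) hij
    · have e (m : Fin (N + 1)) (hm : l + 1 ≤ (m : ℕ)) :
          tailPos h ⟨m - (l + 1), by omega⟩ = m := Fin.ext (by simp [tailPos]; omega)
      have hj : l + 1 ≤ (j : ℕ) := hi.trans hij.le
      have := h₂ (a := ⟨i - (l + 1), by omega⟩) (b := ⟨j - (l + 1), by omega⟩)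
        (by rw [Fin.mk_lt_mk]; omega)
      simpa only [e i hi, e j hj] using this

/-- The decomposition of the positions into the first `l + 1` and the last `k`. -/
def blockEquiv : Fin (l + 1) ⊕ Fin k ≃ Fin (N + 1) :=
  Equiv.ofBijective _ (bijective_blocks h 1)

/-- The permutation acting by `b₁` on the first `l + 1` positions and by `b₂` on the others. -/
def blockPerm (b₁ : Equiv.Perm (Fin (l + 1))) (b₂ : Equiv.Perm (Fin k)) :
    Equiv.Perm (Fin (N + 1)) :=
  (blockEquiv h).permCongr (Equiv.Perm.sumCongr b₁ b₂)

@[simp]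
theorem blockPerm_headPos (b₁ : Equiv.Perm (Fin (l + 1))) (b₂ : Equiv.Perm (Fin k))
    (i : Fin (l + 1)) : blockPerm h b₁ b₂ (headPos h i) = headPos h (b₁ i) := by
  have e : headPos h i = blockEquiv h (Sum.inl i) := rfl
  rw [e, blockPerm, Equiv.permCongr_apply, Equiv.symm_apply_apply]
  rfl

@[simp]
theorem blockPerm_tailPos (b₁ : Equiv.Perm (Fin (l + 1))) (b₂ : Equiv.Perm (Fin k))
    (j : Fin k) : blockPerm h b₁ b₂ (tailPos h j) = tailPos h (b₂ j) := by
  have e : tailPos h j = blockEquiv h (Sum.inr j) := rfl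
  rw [e, blockPerm, Equiv.permCongr_apply, Equiv.symm_apply_apply]
  rfl

theorem sign_blockPerm (b₁ : Equiv.Perm (Fin (l + 1))) (b₂ : Equiv.Perm (Fin k)) :
    Equiv.Perm.sign (blockPerm h b₁ b₂) = Equiv.Perm.sign b₁ * Equiv.Perm.sign b₂ := by
  rw [blockPerm, Equiv.Perm.sign_permCongr, Equiv.Perm.sign_sumCongr]

theorem headPos_injective : Function.Injective (headPos h) := fun a b e => by
  simpa [headPos, Fin.ext_iff] using e

theorem tailPos_injective : Function.Injective (tailPos h) := fun a b e => by
  simpa [tailPos, Fin.ext_iff] using e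

theorem eq_of_headPos_tailPos {X : Type*} {f g : Fin (N + 1) → X}
    (h₁ : ∀ i, f (headPos h i) = g (headPos h i)) (h₂ : ∀ j, f (tailPos h j) = g (tailPos h j)) :
    f = g := by
  funext n
  obtain ⟨i | j, rfl⟩ := (blockEquiv h).surjective n
  exacts [h₁ i, h₂ j]

theorem sum_headPos_add_sum_tailPos {X : Type*} [AddCommMonoid X] (f : Fin (N + 1) → X) :
    ∑ i, f (headPos h i) + ∑ j, f (tailPos h j) = ∑ n, f n := by
  rw [← (blockEquiv h).sum_comp, Fintype.sum_sum_type]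
  rfl

/-- Every permutation is in a unique way the product of a shuffle and a permutation of the
blocks. -/
theorem bijective_shuffle_mul_blockPerm : Function.Bijective
    (fun p : {τ : Equiv.Perm (Fin (N + 1)) // IsShuffle (l + 1) τ} ×
        (Equiv.Perm (Fin (l + 1)) × Equiv.Perm (Fin k)) =>
      p.1.1 * blockPerm h p.2.1 p.2.2) := by
  -- A tuple has only one increasing rearrangement.
  have key {m : ℕ} {f g : Fin m → Fin (N + 1)} {a b : Equiv.Perm (Fin m)} (hf : StrictMono f)
      (hg : StrictMono g) (e : f ∘ a = g ∘ b) : f = g ∧ a = b := by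
    have e' : g ∘ (b * a⁻¹ : Equiv.Perm (Fin m)) = f := by
      funext i
      have := congrFun e (a⁻¹ i)
      simpa using this.symm
    have := Tuple.unique_monotone (f := g) (σ := b * a⁻¹) (τ := 1) (by rw [e']; exact hf.monotone)
      (by simpa using hg.monotone)
    have hfg : f = g := by rw [← e', this]; rfl
    subst hfg
    exact ⟨rfl, Equiv.ext fun i => hf.injective (congrFun e i)⟩
  constructor
  · rintro ⟨⟨τ, hτ⟩, a₁, a₂⟩ ⟨⟨σ, hσ⟩, b₁, b₂⟩ e
    have e : τ * blockPerm h a₁ a₂ = σ * blockPerm h b₁ b₂ := e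
    rw [isShuffle_iff h] at hτ hσ
    obtain ⟨h₁, rfl⟩ := key (a := a₁) (b := b₁) hτ.1 hσ.1 <| by
      funext i
      simpa using congrArg (fun p : Equiv.Perm (Fin (N + 1)) => p (headPos h i)) e
    obtain ⟨h₂, rfl⟩ := key (a := a₂) (b := b₂) hτ.2 hσ.2 <| by
      funext i
      simpa using congrArg (fun p : Equiv.Perm (Fin (N + 1)) => p (tailPos h i)) e
    have : τ = σ := mul_right_cancel e
    subst this
    rfl
  · intro τ
    let b₁ := Tuple.sort fun i => τ (headPos h i)
    let b₂ := Tuple.sort fun j => τ (tailPos h j)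
    refine ⟨⟨⟨τ * blockPerm h b₁ b₂, ?_⟩, b₁⁻¹, b₂⁻¹⟩, ?_⟩
    · rw [isShuffle_iff h]
      simp only [Equiv.Perm.mul_apply, blockPerm_headPos, blockPerm_tailPos]
      exact ⟨(Tuple.monotone_sort fun i => τ (headPos h i)).strictMono_of_injective
          ((τ.injective.comp (headPos_injective h)).comp b₁.injective),
        (Tuple.monotone_sort fun j => τ (tailPos h j)).strictMono_of_injective
          ((τ.injective.comp (tailPos_injective h)).comp b₂.injective)⟩
    · change τ * blockPerm h b₁ b₂ * blockPerm h b₁⁻¹ b₂⁻¹ = τ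
      refine Equiv.ext (congrFun (eq_of_headPos_tailPos h (fun i => ?_) fun j => ?_)) <;> simp

theorem sum_perm_eq_sum_shuffle {X : Type*} [AddCommMonoid X] {G : Equiv.Perm (Fin (N + 1)) → X}
    (hG : ∀ τ b₁ b₂, G (τ * blockPerm h b₁ b₂) = G τ) :
    ∑ τ, G τ = Fintype.card (Equiv.Perm (Fin (l + 1)) × Equiv.Perm (Fin k)) •
      ∑ τ ∈ Finset.univ.filter (IsShuffle (n := N + 1) (l + 1)), G τ := by
  rw [← (bijective_shuffle_mul_blockPerm h).sum_comp G, Fintype.sum_prod_type]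
  simp only [hG, Finset.sum_const, Finset.card_univ]
  rw [← Finset.smul_sum, Finset.sum_subtype (Finset.univ.filter _)
    (p := IsShuffle (n := N + 1) (l + 1)) (by simp)]

/-- A sum over the shuffles of a function on the cosets of the permutations of the blocks
is invariant under left translation. -/
theorem sum_shuffle_mul_left {X : Type*} [AddCommGroup X] [Module ℂ X]
    {G : Equiv.Perm (Fin (N + 1)) → X} (hG : ∀ τ b₁ b₂, G (τ * blockPerm h b₁ b₂) = G τ)
    (σ : Equiv.Perm (Fin (N + 1))) :
    ∑ τ ∈ Finset.univ.filter (IsShuffle (n := N + 1) (l + 1)), G (σ * τ) =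
      ∑ τ ∈ Finset.univ.filter (IsShuffle (n := N + 1) (l + 1)), G τ := by
  have h₁ := sum_perm_eq_sum_shuffle h hG
  have h₂ := sum_perm_eq_sum_shuffle h (G := fun τ => G (σ * τ))
    fun τ b₁ b₂ => by rw [← mul_assoc, hG]
  have h₃ : ∑ τ, G (σ * τ) = ∑ τ, G τ := Fintype.sum_equiv (Equiv.mulLeft σ) _ _ fun _ => rfl
  rw [h₃, h₁, ← Nat.cast_smul_eq_nsmul ℂ, ← Nat.cast_smul_eq_nsmul ℂ] at h₂
  exact (smul_right_injective X (Nat.cast_ne_zero.2 Fintype.card_ne_zero) h₂).symm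

end Shuffles

/-! ### The circle product of cochains is a cochain -/

section Circle

variable {V : Type*} [AddCommGroup V] [Module ℂ V] {D γ : Module.End ℂ V} {k l N : ℕ}
  (h : k + l = N) {f : PreCochain k V V} {g : PreCochain l V V}

variable (γ f g) in
/-- The summand of the circle product that belongs to the identity, at polynomials
`c₁, …, c_{N+1}`. -/
def circAt {n : ℕ} (c : Fin (N + 1) → Lam n) (x : Fin (N + 1) → V) : VPoly n V :=
  insertAt f (∑ i, c (headPos h i)) (fun j => c (tailPos h j))
    (fun j => (γ ^ l) (x (tailPos h j)))
    (evalAt g (fun i => c (headPos h i)) fun i => x (headPos h i))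

theorem circTerm_apply (τ : Equiv.Perm (Fin (N + 1))) (x : Fin (N + 1) → V) :
    circTerm γ h f g τ x =
      circAt γ h f g (fun i => (MvPolynomial.X (τ i) : Lam (N + 1))) (x ∘ τ) := rfl

theorem circ_apply (x : Fin (N + 1) → V) :
    circ D γ h f g x = dag N D (∑ τ ∈ Finset.univ.filter (IsShuffle (n := N + 1) (l + 1)),
      (Equiv.Perm.sign τ : ℤ) •
        circAt γ h f g (fun i => (MvPolynomial.X (τ i) : Lam (N + 1))) (x ∘ τ)) := by
  simp only [circ, LinearMap.compMultilinearMap_apply, sum_apply, smul_apply, circTerm_apply]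

theorem subst_circAt {m n : ℕ} (t : Fin m → Lam n) (c : Fin (N + 1) → Lam m)
    (x : Fin (N + 1) → V) :
    subst t (circAt γ h f g c x) = circAt γ h f g (fun i => MvPolynomial.aeval t (c i)) x := by
  rw [circAt, subst_insertAt, subst_evalAt, map_sum]
  rfl

theorem mapCoeff_circAt (hf : IsCochain D γ D γ f) (hg : IsCochain D γ D γ g) {n : ℕ}
    (c : Fin (N + 1) → Lam n) (x : Fin (N + 1) → V) :
    mapCoeff n γ (circAt γ h f g c x) = circAt γ h f g c fun i => γ (x i) := by
  rw [circAt, hf.mapCoeff_insertAt, hg.mapCoeff_evalAt]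
  have e (v : V) : γ ((γ ^ l) v) = (γ ^ l) (γ v) := by
    rw [← Module.End.mul_apply, ← Module.End.mul_apply, ← pow_succ, ← pow_succ']
  simp only [e]
  rfl

theorem circAt_der (hγ : ∀ v, γ (D v) = D (γ v)) (hf : IsCochain D γ D γ f)
    (hg : IsCochain D γ D γ g) {n : ℕ} (c : Fin (N + 1) → Lam n) (x : Fin (N + 1) → V)
    (m : Fin (N + 1)) :
    circAt γ h f g c (Function.update x m (D (x m))) ≡ -(c m • circAt γ h f g c x)
      [SMOD killed D (∑ i, c i)] := by
  rw [← sum_headPos_add_sum_tailPos h c]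
  have hht (i : Fin (l + 1)) (j : Fin k) : headPos h i ≠ tailPos h j := fun e =>
    Sum.inl_ne_inr ((bijective_blocks h 1).1 (a₁ := Sum.inl i) (a₂ := Sum.inr j) e)
  obtain ⟨i | j, rfl⟩ := (blockEquiv h).surjective m
  · change circAt γ h f g c (Function.update x (headPos h i) (D (x (headPos h i)))) ≡
      -(c (headPos h i) • circAt γ h f g c x) [SMOD _]
    have e₁ : (fun i' => Function.update x (headPos h i) (D (x (headPos h i))) (headPos h i')) =
        Function.update (fun i' => x (headPos h i')) i (D (x (headPos h i))) :=
      Function.update_comp_eq_of_injective x (headPos_injective h) i _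
    have e₂ (j : Fin k) : Function.update x (headPos h i) (D (x (headPos h i))) (tailPos h j) =
        x (tailPos h j) := Function.update_of_ne (hht i j).symm _ _
    simp only [circAt, e₁, e₂]
    refine (hf.insertAt_smodEq _ _ _ (hg.evalAt_der (fun i' => c (headPos h i'))
      (fun i' => x (headPos h i')) i)).trans ?_
    rw [map_neg, map_smul]
  · change circAt γ h f g c (Function.update x (tailPos h j) (D (x (tailPos h j)))) ≡
      -(c (tailPos h j) • circAt γ h f g c x) [SMOD _]
    have e₁ (i : Fin (l + 1)) :
        Function.update x (tailPos h j) (D (x (tailPos h j))) (headPos h i) = x (headPos h i) :=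
      Function.update_of_ne (hht i j) _ _
    have hl (v : V) : (γ ^ l) (D v) = D ((γ ^ l) v) := by
      have : Commute γ D := LinearMap.ext hγ
      exact LinearMap.congr_fun (this.pow_left l) v
    have e₂ : (fun j' => (γ ^ l) (Function.update x (tailPos h j) (D (x (tailPos h j)))
        (tailPos h j'))) = Function.update (fun j' => (γ ^ l) (x (tailPos h j'))) j
          (D ((γ ^ l) (x (tailPos h j)))) := by
      funext j'
      rcases eq_or_ne j' j with rfl | hj
      · simp [hl]
      · rw [Function.update_of_ne hj, Function.update_of_ne ((tailPos_injective h).ne hj)]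
    simp only [circAt, e₁, e₂]
    exact hf.insertAt_der _ _ (fun j' => (γ ^ l) (x (tailPos h j'))) j _

/-- For cochains, the signed summand of the circle product depends only on the coset of the
permutation modulo those of the two blocks. -/
theorem circAt_blockPerm (hf : IsCochain D γ D γ f) (hg : IsCochain D γ D γ g) {n : ℕ}
    (c : Fin (N + 1) → Lam n) (x : Fin (N + 1) → V) (b₁ : Equiv.Perm (Fin (l + 1)))
    (b₂ : Equiv.Perm (Fin k)) :
    circAt γ h f g c x ≡ (Equiv.Perm.sign (blockPerm h b₁ b₂) : ℤ) •
      circAt γ h f g (c ∘ blockPerm h b₁ b₂) (x ∘ blockPerm h b₁ b₂)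
        [SMOD killed D (∑ i, c i)] := by
  rw [← sum_headPos_add_sum_tailPos h c]
  refine (hf.insertAt_smodEq _ _ _ (hg.evalAt_perm (fun i => c (headPos h i))
      (fun i => x (headPos h i)) b₁)).trans ?_
  refine (hf.insertAt_perm _ _ _ b₂ _).trans ?_
  rw [map_zsmul, sign_blockPerm, mul_comm, Units.val_mul, mul_smul]
  have hs : ∑ i, c (headPos h (b₁ i)) = ∑ i, c (headPos h i) :=
    Equiv.sum_comp b₁ fun i => c (headPos h i)
  simp only [circAt, Function.comp_apply, blockPerm_headPos, blockPerm_tailPos, hs]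
  exact SModEq.rfl

theorem isCochain_circ (hγ : ∀ v, γ (D v) = D (γ v)) (hf : IsCochain D γ D γ f)
    (hg : IsCochain D γ D γ g) : IsCochain D γ D γ (circ D γ h f g) := by
  refine IsCochain.of_dag _ (circ_apply h) (fun x => ?_) (fun x i => ?_) (fun σ x => ?_)
  · rw [circ_apply, circ_apply, mapCoeff_dag hγ, map_sum]
    simp only [map_zsmul, mapCoeff_circAt h hf hg]
    rfl
  · rw [Finset.smul_sum, ← Finset.sum_neg_distrib]
    refine SModEq.sum fun τ _ => ?_
    rw [smul_comm, ← smul_neg]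
    refine SModEq.zsmul ?_ _
    have := circAt_der h hγ hf hg (fun i => (MvPolynomial.X (τ i) : Lam (N + 1))) (x ∘ τ) (τ⁻¹ i)
    rw [Equiv.sum_comp τ fun i => (MvPolynomial.X i : Lam (N + 1))] at this
    simpa [Function.update_comp_equiv] using this
  · let G (τ : Equiv.Perm (Fin (N + 1))) :
        VPoly (N + 1) V ⧸ killed D (∑ i, MvPolynomial.X i : Lam (N + 1)) :=
      Submodule.Quotient.mk ((Equiv.Perm.sign τ : ℤ) •
        circAt γ h f g (fun i => (MvPolynomial.X (τ i) : Lam (N + 1))) (x ∘ τ))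
    have hG (τ b₁ b₂) : G (τ * blockPerm h b₁ b₂) = G τ := by
      refine SModEq.symm ?_
      have := circAt_blockPerm h hf hg (fun i => (MvPolynomial.X (τ i) : Lam (N + 1))) (x ∘ τ) b₁ b₂
      rw [Equiv.sum_comp τ fun i => (MvPolynomial.X i : Lam (N + 1))] at this
      rw [Equiv.Perm.sign_mul, Units.val_mul, mul_smul]
      exact this.zsmul _
    have hsum := sum_shuffle_mul_left h hG σ
    rw [map_sum, Finset.smul_sum]
    simp only [G, ← Submodule.mkQ_apply, ← map_sum] at hsum
    refine SModEq.trans hsum.symm ?_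
    convert SModEq.rfl using 1
    refine Finset.sum_congr rfl fun τ _ => ?_
    rw [map_zsmul, subst_circAt, smul_smul, Equiv.Perm.sign_mul, Units.val_mul]
    simp only [MvPolynomial.aeval_X]
    rfl

theorem isCochain_nrBracket (hγ : ∀ v, γ (D v) = D (γ v)) (hf : IsCochain D γ D γ f)
    (hg : IsCochain D γ D γ g) : IsCochain D γ D γ (nrBracket D γ h f g) := by
  have h₁ : circ D γ h f g ∈ cochains D γ D γ N := isCochain_circ h hγ hf hg
  have h₂ : circ D γ ((add_comm l k).trans h) g f ∈ cochains D γ D γ N :=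
    isCochain_circ _ hγ hg hf
  exact Submodule.sub_mem _ h₁ (Submodule.smul_mem _ _ h₂)

end Circle

/-! ### Shuffles with a short block -/

section ShortShuffles

theorem range_tailPos_eq_compl {k l N : ℕ} (h : k + l = N) (τ : Equiv.Perm (Fin (N + 1))) :
    Set.range (fun j => τ (tailPos h j)) = (Set.range fun i => τ (headPos h i))ᶜ := by
  have hb := bijective_blocks h τ
  ext n
  simp only [Set.mem_range, Set.mem_compl_iff]
  constructor
  · rintro ⟨j, rfl⟩ ⟨i, e⟩
    exact Sum.inl_ne_inr (hb.1 (a₁ := Sum.inl i) (a₂ := Sum.inr j) e)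
  · intro hn
    obtain ⟨i | j, rfl⟩ := hb.2 n
    exacts [absurd ⟨i, rfl⟩ hn, ⟨j, rfl⟩]

theorem IsShuffle.eq_of_headPos {k l N : ℕ} (h : k + l = N) {τ σ : Equiv.Perm (Fin (N + 1))}
    (hτ : IsShuffle (l + 1) τ) (hσ : IsShuffle (l + 1) σ)
    (e : ∀ i, τ (headPos h i) = σ (headPos h i)) : τ = σ := by
  rw [isShuffle_iff h] at hτ hσ
  refine Equiv.ext (congrFun (eq_of_headPos_tailPos h e (congrFun ?_)))
  refine (StrictMono.range_inj hτ.2 hσ.2).1 ?_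
  rw [range_tailPos_eq_compl, range_tailPos_eq_compl]
  simp only [e]

theorem IsShuffle.eq_of_tailPos {k l N : ℕ} (h : k + l = N) {τ σ : Equiv.Perm (Fin (N + 1))}
    (hτ : IsShuffle (l + 1) τ) (hσ : IsShuffle (l + 1) σ)
    (e : ∀ j, τ (tailPos h j) = σ (tailPos h j)) : τ = σ := by
  rw [isShuffle_iff h] at hτ hσ
  refine Equiv.ext (congrFun (eq_of_headPos_tailPos h (congrFun ?_) e))
  refine (StrictMono.range_inj hτ.1 hσ.1).1 (compl_injective ?_)
  rw [← range_tailPos_eq_compl, ← range_tailPos_eq_compl]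
  simp only [e]

/-- The `(l + 1, 1)`-shuffle that puts `i` in the last position. -/
def lastPerm {l : ℕ} (i : Fin (l + 2)) : Equiv.Perm (Fin (l + 2)) :=
  i.cycleRange.symm * finRotate (l + 2)

@[simp]
theorem lastPerm_castSucc {l : ℕ} (i : Fin (l + 2)) (m : Fin (l + 1)) :
    lastPerm i m.castSucc = i.succAbove m := by
  rw [lastPerm, Equiv.Perm.mul_apply, ← Fin.cycleRange_symm_succ, finRotate_apply,
    Fin.coeSucc_eq_succ]

@[simp]
theorem lastPerm_last {l : ℕ} (i : Fin (l + 2)) : lastPerm i (Fin.last (l + 1)) = i := by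
  rw [lastPerm, Equiv.Perm.mul_apply, finRotate_last, Fin.cycleRange_symm_zero]

theorem sign_lastPerm {l : ℕ} (i : Fin (l + 2)) :
    Equiv.Perm.sign (lastPerm i) = (-1) ^ (l + 1 + i : ℕ) := by
  have : Equiv.Perm.sign i.cycleRange.symm = (-1) ^ (i : ℕ) := by
    rw [Equiv.Perm.sign_symm, Fin.sign_cycleRange]
  rw [lastPerm, Equiv.Perm.sign_mul, this, sign_finRotate, pow_add, mul_comm]
  rfl

theorem isShuffle_lastPerm {l : ℕ} (i : Fin (l + 2)) : IsShuffle (l + 1) (lastPerm i) := by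
  rw [isShuffle_iff (k := 1) (add_comm 1 l)]
  refine ⟨fun a b hab => ?_, fun a b hab => absurd hab (by rw [Subsingleton.elim a b]; simp)⟩
  exact (lastPerm_castSucc i a).trans_lt
    ((Fin.strictMono_succAbove i hab).trans_eq (lastPerm_castSucc i b).symm)

theorem sum_shuffle_last {X : Type*} [AddCommMonoid X] {l : ℕ} (G : Equiv.Perm (Fin (l + 2)) → X) :
    ∑ τ ∈ Finset.univ.filter (IsShuffle (n := l + 2) (l + 1)), G τ = ∑ i, G (lastPerm i) := by
  refine (Finset.sum_bij (fun i _ => lastPerm i) (fun i _ => ?_) (fun i _ j _ e => ?_)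
    (fun τ hτ => ⟨τ (Fin.last (l + 1)), Finset.mem_univ _, ?_⟩) fun _ _ => rfl).symm
  · simpa using isShuffle_lastPerm i
  · rw [← lastPerm_last i, e, lastPerm_last]
  · refine (isShuffle_lastPerm _).eq_of_tailPos (k := 1) (add_comm 1 l)
      (Finset.mem_filter.1 hτ).2 fun j => ?_
    have : tailPos (add_comm 1 l) j = Fin.last (l + 1) := Fin.ext (by simp [tailPos])
    rw [this, lastPerm_last]

/-- The permutation that puts `j.succAbove i` and `j` in the first two positions and leaves the
order of the others unchanged. -/
def pairPerm {k : ℕ} (j : Fin (k + 2)) (i : Fin (k + 1)) : Equiv.Perm (Fin (k + 2)) :=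
  j.cycleRange.symm * Equiv.Perm.decomposeFin.symm (0, i.cycleRange.symm) * Equiv.swap 0 1

@[simp]
theorem pairPerm_zero {k : ℕ} (j : Fin (k + 2)) (i : Fin (k + 1)) :
    pairPerm j i 0 = j.succAbove i := by
  rw [pairPerm, Equiv.Perm.mul_apply, Equiv.swap_apply_left, ← Fin.succ_zero_eq_one,
    Equiv.Perm.mul_apply, Equiv.Perm.decomposeFin_symm_apply_succ]
  simp

@[simp]
theorem pairPerm_one {k : ℕ} (j : Fin (k + 2)) (i : Fin (k + 1)) : pairPerm j i 1 = j := by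
  simp [pairPerm]

@[simp]
theorem pairPerm_succ_succ {k : ℕ} (j : Fin (k + 2)) (i : Fin (k + 1)) (m : Fin k) :
    pairPerm j i m.succ.succ = j.succAbove (i.succAbove m) := by
  have h₁ : m.succ.succ ≠ 1 := by
    rw [← Fin.succ_zero_eq_one]
    exact (Fin.succ_injective _).ne (Fin.succ_ne_zero m)
  rw [pairPerm, Equiv.Perm.mul_apply, Equiv.swap_apply_of_ne_of_ne (Fin.succ_ne_zero _) h₁]
  simp

theorem sign_pairPerm {k : ℕ} (j : Fin (k + 2)) (i : Fin (k + 1)) :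
    Equiv.Perm.sign (pairPerm j i) = -(-1) ^ (i + j : ℕ) := by
  have h₁ {n : ℕ} (i : Fin n) : Equiv.Perm.sign i.cycleRange.symm = (-1) ^ (i : ℕ) := by
    rw [Equiv.Perm.sign_symm, Fin.sign_cycleRange]
  rw [pairPerm, Equiv.Perm.sign_mul, Equiv.Perm.sign_mul, Equiv.Perm.decomposeFin.symm_sign,
    if_pos rfl, one_mul, h₁, h₁, Equiv.Perm.sign_swap (by simp), ← pow_add, add_comm (j : ℕ)]
  simp

theorem isShuffle_pairPerm {k : ℕ} {j : Fin (k + 2)} {i : Fin (k + 1)} :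
    IsShuffle 2 (pairPerm j i) ↔ i.castSucc < j := by
  rw [isShuffle_iff (l := 1) (N := k + 1) rfl]
  have ht (m : Fin k) : pairPerm j i (tailPos (l := 1) (N := k + 1) rfl m) =
      j.succAbove (i.succAbove m) := by
    rw [← pairPerm_succ_succ]
    congr 1
    exact Fin.ext (by simp [tailPos]; omega)
  rw [← Fin.succAbove_lt_iff_castSucc_lt]
  constructor
  · rintro ⟨h₁, -⟩
    have := h₁ (a := 0) (b := 1) (by simp)
    exact (pairPerm_zero j i).symm.trans_lt (this.trans_eq (pairPerm_one j i))
  · intro hij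
    refine ⟨fun a b hab => ?_, fun a b hab => ?_⟩
    · have ha : a = 0 := Fin.ext (by rw [Fin.val_zero]; omega)
      have hb : b = 1 := Fin.ext (by rw [Fin.val_one]; omega)
      subst ha hb
      exact (pairPerm_zero j i).trans_lt (hij.trans_eq (pairPerm_one j i).symm)
    · simp only [ht]
      exact Fin.strictMono_succAbove j (Fin.strictMono_succAbove i hab)

theorem sum_shuffle_pair {X : Type*} [AddCommMonoid X] {k : ℕ} (G : Equiv.Perm (Fin (k + 2)) → X) :
    ∑ τ ∈ Finset.univ.filter (IsShuffle (n := k + 2) 2), G τ =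
      ∑ j : Fin (k + 2), ∑ i : Fin (k + 1), if i.castSucc < j then G (pairPerm j i) else 0 := by
  rw [← Fintype.sum_prod_type' (f := fun (j : Fin (k + 2)) (i : Fin (k + 1)) =>
    if i.castSucc < j then G (pairPerm j i) else 0), ← Finset.sum_filter]
  refine (Finset.sum_bij (fun p _ => pairPerm p.1 p.2) (fun p hp => ?_) (fun p _ q _ e => ?_)
    (fun τ hτ => ?_) fun _ _ => rfl).symm
  · simpa [isShuffle_pairPerm] using hp
  · obtain ⟨j, i⟩ := p
    obtain ⟨j', i'⟩ := q
    have e : pairPerm j i = pairPerm j' i' := e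
    obtain rfl : j = j' := by rw [← pairPerm_one j i, e, pairPerm_one]
    have : j.succAbove i = j.succAbove i' := by rw [← pairPerm_zero j i, e, pairPerm_zero]
    rw [Fin.succAbove_right_injective this]
  · have hτ := (Finset.mem_filter.1 hτ).2
    have h01 : τ 0 < τ 1 := hτ 0 1 (by simp) (Or.inl (by simp))
    obtain ⟨i, hi⟩ := Fin.exists_succAbove_eq h01.ne
    have hij : i.castSucc < τ 1 := by rwa [← Fin.succAbove_lt_iff_castSucc_lt, hi]
    refine ⟨(τ 1, i), by simpa using hij, ?_⟩
    refine (isShuffle_pairPerm.2 hij).eq_of_headPos (l := 1) (N := k + 1) rfl hτ fun a => ?_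
    fin_cases a
    · exact (pairPerm_zero _ _).trans hi
    · exact pairPerm_one _ _

end ShortShuffles

/-! ### Circle products with a bilinear map -/

section Bilinear

variable {V : Type*} [AddCommGroup V] [Module ℂ V] {D γ : Module.End ℂ V}

theorem insertAt_ofBilinear {n : ℕ} (b : V →ₗ[ℂ] V →ₗ[ℂ] VPoly 1 V) (s : Lam n)
    (c : Fin 1 → Lam n) (y : Fin 1 → V) (u : VPoly n V) :
    insertAt (ofBilinear b) s c y u = lamApply b.flip s (y 0) u := by
  have : (fun j : Fin 1 => (Fin.cons s c : Fin 2 → Lam n) j.castSucc) = fun _ => s := by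
    funext j
    rw [Subsingleton.elim j 0]
    rfl
  rw [insertAt, this]
  rfl

theorem units_int_smul_eq {n : ℕ} (z : ℤˣ) (u : VPoly n V) :
    (z : ℤ) • u = ((z : ℤ) : ℂ) • u :=
  (Int.cast_smul_eq_zsmul ℂ _ u).symm

/-- The terms are indexed by the argument that stays outside of `g`. -/
theorem circ_ofBilinear_left {l : ℕ} (h : 1 + l = l + 1) (b : V →ₗ[ℂ] V →ₗ[ℂ] VPoly 1 V)
    (g : PreCochain l V V) (x : Fin (l + 2) → V) :
    circ D γ h (ofBilinear b) g x = dag (l + 1) D (∑ i : Fin (l + 2), (-1 : ℂ) ^ (l + 1 + i : ℕ) •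
      lamApply b.flip (∑ m, MvPolynomial.X (i.succAbove m) : Lam (l + 2)) ((γ ^ l) (x i))
        (subst (fun m : Fin l => (MvPolynomial.X (i.succAbove m.castSucc) : Lam (l + 2)))
          (g fun m => x (i.succAbove m)))) := by
  rw [circ_apply, sum_shuffle_last]
  refine congrArg (dag (l + 1) D) (Finset.sum_congr rfl fun i _ => ?_)
  have hh (m : Fin (l + 1)) : lastPerm i (headPos h m) = i.succAbove m := lastPerm_castSucc i m
  have ht : lastPerm i (tailPos h 0) = i := by
    have : tailPos h 0 = Fin.last (l + 1) := Fin.ext (by simp [tailPos])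
    rw [this, lastPerm_last]
  have hs : ((Equiv.Perm.sign (lastPerm i) : ℤ) : ℂ) = (-1) ^ (l + 1 + i : ℕ) := by
    rw [sign_lastPerm]
    push_cast
    rfl
  rw [units_int_smul_eq, hs]
  refine congrArg _ ?_
  rw [circAt, insertAt_ofBilinear, evalAt]
  simp only [Function.comp_apply, hh, ht]

/-- The terms are indexed by the two arguments `j.succAbove i < j` that are put into `b`. -/
theorem circ_ofBilinear_right {k : ℕ} (h : k + 1 = k + 1) (f : PreCochain k V V)
    (b : V →ₗ[ℂ] V →ₗ[ℂ] VPoly 1 V) (x : Fin (k + 2) → V) :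
    circ D γ h f (ofBilinear b) x = dag (k + 1) D (-∑ j : Fin (k + 2), ∑ i : Fin (k + 1),
      if i.castSucc < j then (-1 : ℂ) ^ (i + j : ℕ) •
        insertAt f (MvPolynomial.X (j.succAbove i) + MvPolynomial.X j : Lam (k + 2))
          (fun m => MvPolynomial.X (j.succAbove (i.succAbove m)))
          (fun m => γ (x (j.succAbove (i.succAbove m))))
          (subst (fun _ => MvPolynomial.X (j.succAbove i)) (b (x (j.succAbove i)) (x j)))
      else 0) := by
  rw [circ_apply, sum_shuffle_pair, ← Finset.sum_neg_distrib]
  refine congrArg (dag (k + 1) D) (Finset.sum_congr rfl fun j _ => ?_)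
  rw [← Finset.sum_neg_distrib]
  refine Finset.sum_congr rfl fun i _ => ?_
  split_ifs with hij
  swap
  · rw [neg_zero]
  have h₀ : pairPerm j i (headPos h 0) = j.succAbove i := pairPerm_zero j i
  have h₁ : pairPerm j i (headPos h 1) = j := pairPerm_one j i
  have ht (m : Fin k) : pairPerm j i (tailPos h m) = j.succAbove (i.succAbove m) := by
    rw [← pairPerm_succ_succ]
    congr 1
    exact Fin.ext (by simp [tailPos]; omega)
  have hs : ((Equiv.Perm.sign (pairPerm j i) : ℤ) : ℂ) = -(-1) ^ (i + j : ℕ) := by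
    rw [sign_pairPerm]
    push_cast
    rfl
  rw [units_int_smul_eq, hs, neg_smul]
  refine congrArg (fun u => -((-1 : ℂ) ^ (i + j : ℕ) • u)) ?_
  rw [circAt, Fin.sum_univ_two]
  simp only [Function.comp_apply, h₀, h₁, ht, pow_one]
  refine congrArg (insertAt f _ _ _) ?_
  rw [evalAt]
  have : (fun a : Fin 1 => (MvPolynomial.X (pairPerm j i (headPos h a.castSucc)) : Lam (k + 2))) =
      fun _ => MvPolynomial.X (j.succAbove i) := by
    funext a
    rw [Subsingleton.elim a 0]
    exact congrArg _ h₀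
  rw [this]
  change subst _ (b (x (pairPerm j i (headPos h 0))) (x (pairPerm j i (headPos h 1)))) = _
  rw [h₀, h₁]

theorem isCochain_ofBilinear {b : V →ₗ[ℂ] V →ₗ[ℂ] VPoly 1 V}
    (der_left : ∀ x y, b (D x) y = -((MvPolynomial.X 0 : Lam 1) • b x y))
    (der_right : ∀ x y, b x (D y) = mapCoeff 1 D (b x y) + (MvPolynomial.X 0 : Lam 1) • b x y)
    (skew : ∀ x y, b x y = -opposite D (b y x))
    (twist : ∀ x y, mapCoeff 1 γ (b x y) = b (γ x) (γ y)) :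
    IsCochain D γ D γ (ofBilinear b) where
  twist x := twist _ _
  der x i := by
    rw [Subsingleton.elim i 0]
    exact der_left (x 0) (x 1)
  der_last x := by
    rw [Fin.sum_univ_one]
    exact der_right (x 0) (x 1)
  skew τ x := by
    obtain rfl | rfl : τ = 1 ∨ τ = Equiv.swap 0 1 := by
      revert τ
      decide
    · rw [Equiv.Perm.sign_one, Units.val_one, one_smul]
      exact (dag_incl D _).symm
    · rw [Equiv.Perm.sign_swap (by simp), Units.val_neg, Units.val_one, neg_smul, one_smul]
      refine (skew (x 0) (x 1)).trans ?_
      refine congrArg (fun u => -dag 1 D u) ?_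
      have : (fun i : Fin 1 => (MvPolynomial.X (Equiv.swap 0 1 i.castSucc) : Lam 2)) =
          fun _ => MvPolynomial.X 1 := by
        funext i
        rw [Subsingleton.elim i 0]
        simp
      rw [this]
      have e : ofBilinear b (fun i => x (Equiv.swap 0 1 i)) = b (x 1) (x 0) := by
        change b (x (Equiv.swap 0 1 0)) (x (Equiv.swap 0 1 1)) = _
        rw [Equiv.swap_apply_left, Equiv.swap_apply_right]
      rw [e]

end Bilinear

/-! ### Cochains on `L ⊕ M` -/

section DirectSum

variable {L M : Type*} [AddCommGroup L] [Module ℂ L] [AddCommGroup M] [Module ℂ M]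
  {DL αL : Module.End ℂ L} {br : L →ₗ[ℂ] L →ₗ[ℂ] VPoly 1 L}
  {DM βM : Module.End ℂ M} {ρ : L →ₗ[ℂ] M →ₗ[ℂ] VPoly 1 M} {T : M →ₗ[ℂ] L}

theorem lift_apply {k : ℕ} (f : PreCochain k M L) (x : Fin (k + 1) → L × M) :
    lift f x = mapCoeff k (LinearMap.inl ℂ L M) (f fun i => (x i).2) := rfl

theorem component_lift {k : ℕ} (f : PreCochain k M L) : component (lift f) = f := by
  ext x
  change mapCoeff k (LinearMap.fst ℂ L M) (mapCoeff k (LinearMap.inl ℂ L M) (f x)) = f x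
  rw [mapCoeff_mapCoeff, LinearMap.fst_comp_inl, mapCoeff_id]

theorem snd_update {ι L M : Type*} [DecidableEq ι] (x : ι → L × M) (i : ι) (y : L × M) :
    (fun j => (Function.update x i y j).2) = Function.update (fun j => (x j).2) i y.2 :=
  Function.comp_update Prod.snd x i y

theorem isCochain_lift {k : ℕ} {f : PreCochain k M L} (hf : IsCochain DM βM DL αL f) :
    IsCochain (DL.prodMap DM) (αL.prodMap βM) (DL.prodMap DM) (αL.prodMap βM) (lift f) where
  twist x := by
    have e : αL.prodMap βM ∘ₗ LinearMap.inl ℂ L M = LinearMap.inl ℂ L M ∘ₗ αL := by ext <;> simp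
    rw [lift_apply, mapCoeff_mapCoeff, e, ← mapCoeff_mapCoeff, hf.twist]
    rfl
  der x i := by
    rw [lift_apply, snd_update, lift_apply, ← mapCoeff_smul, ← map_neg]
    exact congrArg _ (hf.der (fun j => (x j).2) i)
  der_last x := by
    have e : DL.prodMap DM ∘ₗ LinearMap.inl ℂ L M = LinearMap.inl ℂ L M ∘ₗ DL := by ext <;> simp
    rw [lift_apply, snd_update, lift_apply, mapCoeff_mapCoeff, e, ← mapCoeff_mapCoeff,
      ← mapCoeff_smul, ← map_add]
    exact congrArg _ (hf.der_last fun j => (x j).2)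
  skew τ x := by
    rw [lift_apply, lift_apply, subst_mapCoeff, ← mapCoeff_dag (D := DL) (by simp), ← map_zsmul]
    exact congrArg _ (hf.skew τ fun j => (x j).2)

theorem isCochain_component {k : ℕ} {f : PreCochain k (L × M) (L × M)}
    (hf : IsCochain (DL.prodMap DM) (αL.prodMap βM) (DL.prodMap DM) (αL.prodMap βM) f) :
    IsCochain DM βM DL αL (component f) := by
  have ha (x : Fin (k + 1) → M) : component f x =
    mapCoeff k (LinearMap.fst ℂ L M) (f fun i => (0, x i)) := rfl
  have hu (x : Fin (k + 1) → M) (i : Fin (k + 1)) :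
      (fun j => ((0 : L), Function.update x i (DM (x i)) j)) =
        Function.update (fun j => ((0 : L), x j)) i (DL.prodMap DM (0, x i)) := by
    have : DL.prodMap DM ((0 : L), x i) = (0, DM (x i)) := by simp
    rw [this]
    exact Function.comp_update (fun m : M => ((0 : L), m)) x i _
  constructor
  · intro x
    have e : αL ∘ₗ LinearMap.fst ℂ L M = LinearMap.fst ℂ L M ∘ₗ αL.prodMap βM := by ext <;> simp
    rw [ha, mapCoeff_mapCoeff, e, ← mapCoeff_mapCoeff, hf.twist, ha]
    simp
  · intro x i
    rw [ha, ha, hu, hf.der (fun j => ((0 : L), x j)) i, map_neg, mapCoeff_smul]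
  · intro x
    have e : DL ∘ₗ LinearMap.fst ℂ L M = LinearMap.fst ℂ L M ∘ₗ DL.prodMap DM := by ext <;> simp
    rw [ha, ha, hu, hf.der_last fun j => ((0 : L), x j), map_add, mapCoeff_smul,
      mapCoeff_mapCoeff, mapCoeff_mapCoeff, e]
  · intro τ x
    rw [ha, ha, hf.skew τ, map_zsmul, mapCoeff_dag (D' := DL) (by simp), ← subst_mapCoeff]

theorem insertAt_lift {k n : ℕ} (f : PreCochain k M L) (s : Lam n) (c : Fin k → Lam n)
    (y : Fin k → L × M) (u : VPoly n (L × M)) :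
    insertAt (lift f) s c y u = mapCoeff n (LinearMap.inl ℂ L M)
      (insertAt f s c (fun j => (y j).2) (mapCoeff n (LinearMap.snd ℂ L M) u)) := by
  rw [insertAt, insertAt, extend_mapCoeff, mapCoeff_extend]
  refine congrArg (fun φ => extend φ u) (LinearMap.ext fun a => ?_)
  simp only [LinearMap.comp_apply, ← subst_mapCoeff]
  refine congrArg (subst _) ?_
  change mapCoeff k _ (f fun i => ((Fin.cons a y : Fin (k + 1) → L × M) i).2) =
    mapCoeff k _ (f (Fin.cons a.2 fun j => (y j).2))
  refine congrArg (fun z => mapCoeff k _ (f z)) ?_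
  funext i
  induction i using Fin.cases <;> rfl

theorem semidirectBracket_apply (x y : L × M) : semidirectBracket br DM ρ x y =
    mapCoeff 1 (LinearMap.inl ℂ L M) (br x.1 y.1) +
      mapCoeff 1 (LinearMap.inr ℂ L M) (ρ x.1 y.2) -
        mapCoeff 1 (LinearMap.inr ℂ L M) (opposite DM (ρ y.1 x.2)) := rfl

theorem semidirectBracket_skew (hL : IsHomLieConformal DL αL br) (x y : L × M) :
    semidirectBracket br DM ρ x y =
      -opposite (DL.prodMap DM) (semidirectBracket br DM ρ y x) := by
  simp only [semidirectBracket_apply, map_add, map_sub]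
  rw [← mapCoeff_opposite (D := DL) (by simp), ← mapCoeff_opposite (D := DM) (by simp),
    ← mapCoeff_opposite (D := DM) (by simp), opposite_opposite, hL.skew x.1 y.1, map_neg]
  abel

theorem isCochain_semidirectBracket (hL : IsHomLieConformal DL αL br)
    (hρ : IsRepresentation DL αL br DM βM ρ) :
    IsCochain (DL.prodMap DM) (αL.prodMap βM) (DL.prodMap DM) (αL.prodMap βM)
      (ofBilinear (semidirectBracket br DM ρ)) := by
  have e₁ : DL.prodMap DM ∘ₗ LinearMap.inl ℂ L M = LinearMap.inl ℂ L M ∘ₗ DL := by ext <;> simp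
  have e₂ : DL.prodMap DM ∘ₗ LinearMap.inr ℂ L M = LinearMap.inr ℂ L M ∘ₗ DM := by ext <;> simp
  have e₃ : αL.prodMap βM ∘ₗ LinearMap.inl ℂ L M = LinearMap.inl ℂ L M ∘ₗ αL := by ext <;> simp
  have e₄ : αL.prodMap βM ∘ₗ LinearMap.inr ℂ L M = LinearMap.inr ℂ L M ∘ₗ βM := by ext <;> simp
  have hc (u : VPoly 1 M) : opposite DM (mapCoeff 1 DM u) = mapCoeff 1 DM (opposite DM u) :=
    (mapCoeff_opposite (fun _ => rfl) _).symm
  refine isCochain_ofBilinear (fun x y => ?_) (fun x y => ?_) (semidirectBracket_skew hL)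
    fun x y => ?_
  · simp only [semidirectBracket_apply, LinearMap.prodMap_apply, hL.der_left, hρ.der_left,
      hρ.der_right, map_add, map_neg, map_sub, mapCoeff_smul, opposite_smul_X, hc, smul_add,
      smul_sub]
    abel
  · simp only [semidirectBracket_apply, LinearMap.prodMap_apply, hL.der_right, hρ.der_left,
      hρ.der_right, map_add, map_neg, map_sub, mapCoeff_smul, opposite_smul_X, mapCoeff_mapCoeff,
      e₁, e₂, smul_add, smul_sub]
    abel
  · simp only [semidirectBracket_apply, LinearMap.prodMap_apply, map_add, map_sub,
      mapCoeff_mapCoeff, e₃, e₄, ← hL.twist_bracket, ← hρ.twist_action]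
    simp only [← mapCoeff_opposite hρ.twist_der, mapCoeff_mapCoeff]

theorem isCochain_ofLinear (hT : IsOOperator DL αL br DM βM ρ T) :
    IsCochain DM βM DL αL (ofLinear T) := by
  have ha (x : Fin 1 → M) : ofLinear T x = const 0 (T (x 0)) := rfl
  constructor
  · intro x
    rw [ha, ha, mapCoeff_const, hT.map_twist]
  · exact fun x i => i.elim0
  · intro x
    rw [ha, ha, mapCoeff_const, ← hT.map_der]
    simp
  · intro τ x
    rw [Subsingleton.elim (α := Equiv.Perm (Fin 1)) τ 1, Equiv.Perm.sign_one, Units.val_one, one_smul, ha, ha, subst_const,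
      ← dag_incl DL (const 0 _), incl, subst_const]
    rfl

/-! ### The bracket `[m_c + ρ, T]` -/

variable (T) in
/-- The map `x + m ↦ T m` on `L ⊕ M`. -/
def liftLinear : Module.End ℂ (L × M) := LinearMap.inl ℂ L M ∘ₗ T ∘ₗ LinearMap.snd ℂ L M

variable (br DM ρ T) in
/-- The bracket `[T x_λ y] + [x_λ T y] - T [x_λ y]` on `L ⊕ M`, for the semidirect product bracket
and `T` extended by zero to `L ⊕ M`. -/
def derivedSemidirect : (L × M) →ₗ[ℂ] (L × M) →ₗ[ℂ] VPoly 1 (L × M) :=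
  semidirectBracket br DM ρ ∘ₗ liftLinear T +
    (semidirectBracket br DM ρ).compl₂ (liftLinear T) -
      (semidirectBracket br DM ρ).compr₂ (mapCoeff 1 (liftLinear T))

theorem derivedSemidirect_apply (x y : L × M) : derivedSemidirect br DM ρ T x y =
    semidirectBracket br DM ρ (T x.2, 0) y + semidirectBracket br DM ρ x (T y.2, 0) -
      mapCoeff 1 (liftLinear T) (semidirectBracket br DM ρ x y) := rfl

/-- On `M`, the bracket `[m_c + ρ, T]` is that of the sub-adjacent algebra. -/
theorem mapCoeff_snd_derivedSemidirect (x y : L × M) :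
    mapCoeff 1 (LinearMap.snd ℂ L M) (derivedSemidirect br DM ρ T x y) =
      subadjacentBracket DM ρ T x.2 y.2 := by
  have e : LinearMap.snd ℂ L M ∘ₗ liftLinear T = 0 := by ext <;> simp [liftLinear]
  simp only [derivedSemidirect_apply, semidirectBracket_apply, map_add, map_sub, mapCoeff_mapCoeff,
    LinearMap.snd_comp_inl, LinearMap.snd_comp_inr, mapCoeff_zero, mapCoeff_id,
    ← LinearMap.comp_assoc, e, LinearMap.zero_comp, map_zero, subadjacentBracket_apply]
  abel

/-- Between `L` and `M`, the bracket `[m_c + ρ, T]` is the action `ρ_T`. -/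
theorem derivedSemidirect_inl (hL : IsHomLieConformal DL αL br)
    (hT : IsOOperator DL αL br DM βM ρ T) (a : L) (y : L × M) :
    derivedSemidirect br DM ρ T (a, 0) y =
      -mapCoeff 1 (LinearMap.inl ℂ L M) (opposite DL (inducedAction br DM ρ T y.2 a)) := by
  have e₁ : liftLinear T ∘ₗ LinearMap.inl ℂ L M = 0 := by ext <;> simp [liftLinear]
  have e₂ : liftLinear T ∘ₗ LinearMap.inr ℂ L M = LinearMap.inl ℂ L M ∘ₗ T := by
    ext <;> simp [liftLinear]
  have h := hL.skew a (T y.2)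
  simp only [derivedSemidirect_apply, semidirectBracket_apply, inducedAction_apply, map_add,
    map_sub, mapCoeff_mapCoeff, map_zero, e₁, e₂, mapCoeff_zero, LinearMap.zero_apply, h, map_neg,
    ← mapCoeff_opposite hT.map_der, opposite_opposite]
  abel

theorem subst_X_zero {V : Type*} [AddCommGroup V] [Module ℂ V] (u : VPoly 1 V) :
    subst (fun _ => (MvPolynomial.X 0 : Lam 2)) u = incl u := by
  rw [incl]
  congr 2
  funext i
  rw [Subsingleton.elim i 0]
  rfl

theorem insertAt_ofLinear {n : ℕ} (s : Lam n) (c : Fin 0 → Lam n) (y : Fin 0 → M)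
    (u : VPoly n M) : insertAt (ofLinear T) s c y u = mapCoeff n T u := by
  induction u using VPoly.induction with
  | const a =>
    rw [insertAt_const, mapCoeff_const]
    exact subst_const _ _
  | smul q u hu => rw [map_smul, mapCoeff_smul, hu]
  | add u v hu hv => rw [map_add, map_add, hu, hv]

theorem nrBracket_semidirectBracket (hL : IsHomLieConformal DL αL br) :
    nrBracket (DL.prodMap DM) (αL.prodMap βM) (k := 1) (l := 0) (N := 1) rfl
      (ofBilinear (semidirectBracket br DM ρ)) (lift (ofLinear T)) =
    ofBilinear (derivedSemidirect br DM ρ T) := by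
  ext1 x
  have hT' (z : Fin 1 → L × M) : lift (ofLinear T) z = const 0 (T (z 0).2, 0) := rfl
  have h₁ : circ (DL.prodMap DM) (αL.prodMap βM) (k := 1) (l := 0) (N := 1) rfl
      (ofBilinear (semidirectBracket br DM ρ)) (lift (ofLinear T)) x =
      semidirectBracket br DM ρ (T (x 0).2, 0) (x 1) +
        semidirectBracket br DM ρ (x 0) (T (x 1).2, 0) := by
    rw [semidirectBracket_skew hL (x 0)]
    refine (circ_ofBilinear_left (l := 0) _ _ _ x).trans ?_
    rw [Fin.sum_univ_two]
    simp only [hT', subst_const, lamApply_eq_extend, extend_const]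
    have e₀ : (fun _ : Fin 1 => ∑ m : Fin 1, (MvPolynomial.X ((0 : Fin 2).succAbove m) : Lam 2)) =
        fun _ => MvPolynomial.X 1 := by
      funext
      rw [Fin.sum_univ_one]
      rfl
    have e₁ : (fun _ : Fin 1 => ∑ m : Fin 1, (MvPolynomial.X ((1 : Fin 2).succAbove m) : Lam 2)) =
        fun _ => MvPolynomial.X 0 := by
      funext
      rw [Fin.sum_univ_one]
      rfl
    change dag 1 (DL.prodMap DM) ((-1 : ℂ) ^ 1 •
      subst (fun _ : Fin 1 => ∑ m : Fin 1, (MvPolynomial.X ((0 : Fin 2).succAbove m) : Lam 2))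
        (semidirectBracket br DM ρ (T (x 1).2, 0) (x 0)) + (-1 : ℂ) ^ 2 •
      subst (fun _ : Fin 1 => ∑ m : Fin 1, (MvPolynomial.X ((1 : Fin 2).succAbove m) : Lam 2))
        (semidirectBracket br DM ρ (T (x 0).2, 0) (x 1))) = _
    rw [e₀, e₁, subst_X_zero, map_add, map_smul, map_smul, dag_incl, pow_one, neg_one_sq, one_smul,
      neg_one_smul, add_comm]
    rfl
  have h₂ : circ (DL.prodMap DM) (αL.prodMap βM) (k := 0) (l := 1) (N := 1) rfl
      (lift (ofLinear T)) (ofBilinear (semidirectBracket br DM ρ)) x =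
      mapCoeff 1 (liftLinear T) (semidirectBracket br DM ρ (x 0) (x 1)) := by
    refine (circ_ofBilinear_right (k := 0) _ _ _ x).trans ?_
    rw [Fin.sum_univ_two, Fin.sum_univ_one, Fin.sum_univ_one]
    rw [if_neg (by decide), if_pos (by decide), insertAt_lift, insertAt_ofLinear, mapCoeff_mapCoeff,
      mapCoeff_mapCoeff]
    change dag 1 (DL.prodMap DM) (-(0 + (-1 : ℂ) ^ 1 • mapCoeff 2 (liftLinear T)
      (subst (fun _ => MvPolynomial.X 0) (semidirectBracket br DM ρ (x 0) (x 1))))) = _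
    rw [zero_add, pow_one, neg_one_smul, neg_neg, ← subst_mapCoeff, subst_X_zero, dag_incl]
  change circ _ _ _ _ _ x - (-1 : ℂ) ^ (1 * 0) • circ _ _ _ _ _ x =
    derivedSemidirect br DM ρ T (x 0) (x 1)
  rw [h₁, h₂, mul_zero, pow_zero, one_smul, derivedSemidirect_apply]

end DirectSum

/-! ### The two differentials -/

section Differentials

variable {L M : Type*} [AddCommGroup L] [Module ℂ L] [AddCommGroup M] [Module ℂ M]
  {DL αL : Module.End ℂ L} {br : L →ₗ[ℂ] L →ₗ[ℂ] VPoly 1 L}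
  {DM βM : Module.End ℂ M} {ρ : L →ₗ[ℂ] M →ₗ[ℂ] VPoly 1 M} {T : M →ₗ[ℂ] L}

theorem pow_prodMap_snd (k : ℕ) (x : L × M) :
    (((αL.prodMap βM : Module.End ℂ (L × M)) ^ k) x).2 = (βM ^ k) x.2 := by
  induction k generalizing x with
  | zero => rfl
  | succ k ih => rw [pow_succ, pow_succ, Module.End.mul_apply, ih]; rfl

theorem smul_smodEq_smul {V : Type*} [AddCommGroup V] [Module ℂ V] {n : ℕ}
    {S : Submodule (Lam n) (VPoly n V)} (c : ℂ) {u v : VPoly n V} (h : u ≡ v [SMOD S]) :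
    c • u ≡ c • v [SMOD S] := by
  rw [SModEq.sub_mem, ← smul_sub]
  exact S.smul_of_tower_mem c (SModEq.sub_mem.1 h)

/-- The polynomial form of `derivedSemidirect_inl`: with `u` in the left slot at `c`, the element
`y` acts at the complementary variable `d`. -/
theorem lamApply_derivedSemidirect_smodEq (hL : IsHomLieConformal DL αL br)
    (hT : IsOOperator DL αL br DM βM ρ T) {n : ℕ} {c d s : Lam n} (h : c + d = s) (y : L × M)
    (u : VPoly n L) :
    lamApply (derivedSemidirect br DM ρ T).flip c y (mapCoeff n (LinearMap.inl ℂ L M) u) ≡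
      -mapCoeff n (LinearMap.inl ℂ L M) (lamApply (inducedAction br DM ρ T) d y.2 u)
        [SMOD killed (DL.prodMap DM) s] := by
  simp only [lamApply_eq_extend]
  induction u using VPoly.induction with
  | const a =>
    rw [mapCoeff_const, extend_const, extend_const]
    change subst _ (derivedSemidirect br DM ρ T (a, 0) y) ≡ _ [SMOD _]
    rw [derivedSemidirect_inl hL hT, map_neg, subst_mapCoeff]
    exact (mapCoeff_smodEq (D := DL) (by simp) (subst_opposite_smodEq DL h _)).neg
  | smul q u hu =>
    rw [mapCoeff_smul, map_smul, map_smul, mapCoeff_smul, ← smul_neg]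
    exact hu.smul q
  | add u v hu hv =>
    rw [map_add, map_add, map_add, map_add, neg_add]
    exact hu.add hv

theorem differential_apply {A V : Type*} [AddCommGroup A] [Module ℂ A] [AddCommGroup V]
    [Module ℂ V] (α : Module.End ℂ A) (b : A →ₗ[ℂ] A →ₗ[ℂ] VPoly 1 A) (D : Module.End ℂ V)
    (r : A →ₗ[ℂ] V →ₗ[ℂ] VPoly 1 V) {k : ℕ} (f : PreCochain k A V) (x : Fin (k + 2) → A) :
    differential α b D r k f x = dag (k + 1) D
      (∑ i : Fin (k + 2), (-1 : ℂ) ^ (i : ℕ) • lamApply r (MvPolynomial.X i) ((α ^ k) (x i))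
        (subst (fun m : Fin k => (MvPolynomial.X (i.succAbove m.castSucc) : Lam (k + 2)))
          (f fun m => x (i.succAbove m))) +
      ∑ j : Fin (k + 2), ∑ i : Fin (k + 1),
        if i.castSucc < j then (-1 : ℂ) ^ (i + j : ℕ) •
          insertAt f (MvPolynomial.X (j.succAbove i) + MvPolynomial.X j : Lam (k + 2))
            (fun m => MvPolynomial.X (j.succAbove (i.succAbove m)))
            (fun m => α (x (j.succAbove (i.succAbove m))))
            (subst (fun _ => MvPolynomial.X (j.succAbove i)) (b (x (j.succAbove i)) (x j)))
        else 0) := by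
  refine congrArg (dag (k + 1) D) ?_
  rw [add_apply, sum_apply, sum_apply]
  refine congrArg₂ _ rfl (Finset.sum_congr rfl fun j _ => ?_)
  rw [sum_apply]
  refine Finset.sum_congr rfl fun i _ => ?_
  split_ifs <;> rfl

/-- The derived bracket with `T` is `(-1)^p` times the differential of the sub-adjacent algebra,
already on `L ⊕ M`. -/
theorem derivedBracket_eq (hL : IsHomLieConformal DL αL br)
    (hT : IsOOperator DL αL br DM βM ρ T) {k : ℕ} (P : PreCochain k M L) :
    derivedBracket DL αL br DM βM ρ (Nat.add_comm 1 k) (ofLinear T) P =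
      lift ((-1 : ℂ) ^ (k + 1) •
        differential βM (subadjacentBracket DM ρ T) DL (inducedAction br DM ρ T) k P) := by
  ext1 x
  have hstep : derivedBracket DL αL br DM βM ρ (Nat.add_comm 1 k) (ofLinear T) P x =
      -(circ (DL.prodMap DM) (αL.prodMap βM) (Nat.add_comm 1 k)
          (ofBilinear (derivedSemidirect br DM ρ T)) (lift P) x -
        (-1 : ℂ) ^ k • circ (DL.prodMap DM) (αL.prodMap βM) (k := k) (l := 1) rfl (lift P)
          (ofBilinear (derivedSemidirect br DM ρ T)) x) := by
    have := nrBracket_semidirectBracket (αL := αL) (DM := DM) (βM := βM) (ρ := ρ) (T := T) hL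
    unfold derivedBracket
    rw [this]
    change (-1 : ℂ) ^ (0 + 1) • (circ _ _ _ _ _ x - (-1 : ℂ) ^ (1 * k) • circ _ _ _ _ _ x) = _
    have hp : (-1 : ℂ) ^ (0 + 1) = -1 := by norm_num
    have hk : (-1 : ℂ) ^ (1 * k) = (-1) ^ k := by rw [one_mul]
    rw [hp, hk, neg_one_smul]
  rw [hstep, circ_ofBilinear_left, circ_ofBilinear_right, lift_apply, smul_apply,
    differential_apply]
  rw [map_smul, mapCoeff_dag (D' := DL.prodMap DM) (by simp)]
  -- `lastPerm i` has the sign `(-1)^(k + 1 + i)`, and moving `ρ_T` to the left gives one more sign.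
  have hA : dag (k + 1) (DL.prodMap DM) (∑ i : Fin (k + 2), (-1 : ℂ) ^ (k + 1 + i : ℕ) •
      lamApply (derivedSemidirect br DM ρ T).flip
        (∑ m, MvPolynomial.X (i.succAbove m) : Lam (k + 2)) (((αL.prodMap βM) ^ k) (x i))
        (subst (fun m : Fin k => (MvPolynomial.X (i.succAbove m.castSucc) : Lam (k + 2)))
          (lift P fun m => x (i.succAbove m)))) =
      (-1 : ℂ) ^ k • dag (k + 1) (DL.prodMap DM) (mapCoeff (k + 2) (LinearMap.inl ℂ L M)
        (∑ i : Fin (k + 2), (-1 : ℂ) ^ (i : ℕ) •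
          lamApply (inducedAction br DM ρ T) (MvPolynomial.X i) ((βM ^ k) (x i).2)
            (subst (fun m : Fin k => (MvPolynomial.X (i.succAbove m.castSucc) : Lam (k + 2)))
              (P fun m => (x (i.succAbove m)).2)))) := by
    rw [← map_smul, map_sum (mapCoeff _ _), Finset.smul_sum]
    refine dag_eq_of_smodEq (SModEq.sum fun i _ => ?_)
    have hs : (∑ m, MvPolynomial.X (i.succAbove m) : Lam (k + 2)) + MvPolynomial.X i =
        ∑ m, MvPolynomial.X m := by rw [Fin.sum_univ_succAbove _ i]; exact add_comm _ _
    have := (lamApply_derivedSemidirect_smodEq hL hT hs (((αL.prodMap βM) ^ k) (x i))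
      (subst (fun m : Fin k => (MvPolynomial.X (i.succAbove m.castSucc) : Lam (k + 2)))
          (P fun m => (x (i.succAbove m)).2)))
    rw [pow_prodMap_snd] at this
    rw [lift_apply, subst_mapCoeff]
    refine (smul_smodEq_smul ((-1 : ℂ) ^ (k + 1 + i : ℕ)) this).trans ?_
    rw [map_smul, smul_smul, smul_neg, ← neg_smul, ← pow_add]
    convert SModEq.rfl using 2
    ring
  have hB (j : Fin (k + 2)) (i : Fin (k + 1)) :
      insertAt (lift P) (MvPolynomial.X (j.succAbove i) + MvPolynomial.X j : Lam (k + 2))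
        (fun m => MvPolynomial.X (j.succAbove (i.succAbove m)))
        (fun m => (αL.prodMap βM) (x (j.succAbove (i.succAbove m))))
        (subst (fun _ => MvPolynomial.X (j.succAbove i))
          (derivedSemidirect br DM ρ T (x (j.succAbove i)) (x j))) =
      mapCoeff (k + 2) (LinearMap.inl ℂ L M) (insertAt P
        (MvPolynomial.X (j.succAbove i) + MvPolynomial.X j : Lam (k + 2))
        (fun m => MvPolynomial.X (j.succAbove (i.succAbove m)))
        (fun m => βM (x (j.succAbove (i.succAbove m))).2)
        (subst (fun _ => MvPolynomial.X (j.succAbove i))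
          (subadjacentBracket DM ρ T (x (j.succAbove i)).2 (x j).2))) := by
    rw [insertAt_lift, ← subst_mapCoeff, mapCoeff_snd_derivedSemidirect]
    rfl
  have hB' : (∑ j : Fin (k + 2), ∑ i : Fin (k + 1), if i.castSucc < j then
      (-1 : ℂ) ^ (i + j : ℕ) • insertAt (lift P)
        (MvPolynomial.X (j.succAbove i) + MvPolynomial.X j : Lam (k + 2))
        (fun m => MvPolynomial.X (j.succAbove (i.succAbove m)))
        (fun m => (αL.prodMap βM) (x (j.succAbove (i.succAbove m))))
        (subst (fun _ => MvPolynomial.X (j.succAbove i))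
          (derivedSemidirect br DM ρ T (x (j.succAbove i)) (x j))) else 0) =
      mapCoeff (k + 2) (LinearMap.inl ℂ L M) (∑ j : Fin (k + 2), ∑ i : Fin (k + 1),
        if i.castSucc < j then (-1 : ℂ) ^ (i + j : ℕ) • insertAt P
          (MvPolynomial.X (j.succAbove i) + MvPolynomial.X j : Lam (k + 2))
          (fun m => MvPolynomial.X (j.succAbove (i.succAbove m)))
          (fun m => βM (x (j.succAbove (i.succAbove m))).2)
          (subst (fun _ => MvPolynomial.X (j.succAbove i))
            (subadjacentBracket DM ρ T (x (j.succAbove i)).2 (x j).2)) else 0) := by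
    rw [map_sum]
    refine Finset.sum_congr rfl fun j _ => ?_
    rw [map_sum]
    refine Finset.sum_congr rfl fun i _ => ?_
    rw [apply_ite (mapCoeff (k + 2) (LinearMap.inl ℂ L M)), map_zero, hB, map_smul]
  rw [hA, hB', map_neg, map_add (mapCoeff _ _), map_add, pow_succ, mul_neg_one, neg_smul, smul_add,
    smul_neg, sub_neg_eq_add]

/-- Equal submodules have the same quotients. -/
theorem exists_quotient_equiv {X : Type*} [AddCommGroup X] [Module ℂ X]
    {Z₁ Z₂ B₁ B₂ : Submodule ℂ X} (hZ : Z₁ = Z₂) (hB : B₁ = B₂) :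
    ∃ e : (Z₁ ⧸ B₁.submoduleOf Z₁) ≃ₗ[ℂ] (Z₂ ⧸ B₂.submoduleOf Z₂),
      ∀ (P : X) (h₁ : P ∈ Z₁) (h₂ : P ∈ Z₂),
        e (Submodule.Quotient.mk ⟨P, h₁⟩) = Submodule.Quotient.mk ⟨P, h₂⟩ := by
  subst hZ hB
  exact ⟨LinearEquiv.refl ℂ _, fun _ _ _ => rfl⟩

theorem oDifferential_eq (hL : IsHomLieConformal DL αL br)
    (hT : IsOOperator DL αL br DM βM ρ T) {k : ℕ} (P : PreCochain k M L) :
    oDifferential DL αL br DM βM ρ T k P = (-1 : ℂ) ^ (k + 1) •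
      differential βM (subadjacentBracket DM ρ T) DL (inducedAction br DM ρ T) k P := by
  rw [← component_lift ((-1 : ℂ) ^ (k + 1) •
    differential βM (subadjacentBracket DM ρ T) DL (inducedAction br DM ρ T) k P),
    ← derivedBracket_eq hL hT]
  rfl

theorem oDifferential_mem_cochains (hL : IsHomLieConformal DL αL br)
    (hρ : IsRepresentation DL αL br DM βM ρ) (hT : IsOOperator DL αL br DM βM ρ T) {k : ℕ}
    {P : PreCochain k M L} (hP : P ∈ cochains DM βM DL αL k) :
    oDifferential DL αL br DM βM ρ T k P ∈ cochains DM βM DL αL (k + 1) := by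
  have hγ (v : L × M) : (αL.prodMap βM) ((DL.prodMap DM) v) = (DL.prodMap DM) ((αL.prodMap βM) v) :=
    Prod.ext (hL.twist_der v.1) (hρ.twist_der v.2)
  have h₁ := isCochain_nrBracket (k := 1) (l := 0) (N := 1) rfl hγ
    (isCochain_semidirectBracket hL hρ) (isCochain_lift (isCochain_ofLinear hT))
  have h₂ := isCochain_nrBracket (k := 1) (l := k) (N := k + 1) (Nat.add_comm 1 k) hγ h₁
    (isCochain_lift hP)
  have h₃ : _ ∈ cochains DM βM DL αL (k + 1) := isCochain_component h₂
  have h₄ := Submodule.smul_mem _ ((-1 : ℂ) ^ (0 + 1)) h₃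
  rwa [← map_smul] at h₄

end Differentials

end HomLieConformal

end

theorem mainTheorem3 {L M : Type*} [AddCommGroup L] [Module ℂ L] [AddCommGroup M] [Module ℂ M]
    (DL αL : Module.End ℂ L) (br : L →ₗ[ℂ] L →ₗ[ℂ] VPoly 1 L)
    (hL : IsHomLieConformal DL αL br)
    (DM βM : Module.End ℂ M) (ρ : L →ₗ[ℂ] M →ₗ[ℂ] VPoly 1 M)
    (hρ : IsRepresentation DL αL br DM βM ρ)
    (T : M →ₗ[ℂ] L) (hT : IsOOperator DL αL br DM βM ρ T) :
    IsHomLieConformal DM βM (subadjacentBracket DM ρ T) ∧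
    IsRepresentation DM βM (subadjacentBracket DM ρ T) DL αL (inducedAction br DM ρ T) ∧
    (∀ (k : ℕ), ∀ P ∈ cochains DM βM DL αL k,
      differential βM (subadjacentBracket DM ρ T) DL (inducedAction br DM ρ T) k P ∈
        cochains DM βM DL αL (k + 1) ∧
      oDifferential DL αL br DM βM ρ T k P ∈ cochains DM βM DL αL (k + 1) ∧
      derivedBracket DL αL br DM βM ρ (Nat.add_comm 1 k) (ofLinear T) P =
        lift (oDifferential DL αL br DM βM ρ T k P) ∧
      oDifferential DL αL br DM βM ρ T k P =
        (-1 : ℂ) ^ (k + 1) •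
          differential βM (subadjacentBracket DM ρ T) DL (inducedAction br DM ρ T) k P) ∧
    (∀ k : ℕ,
      cocycles (cochains DM βM DL αL) (oDifferential DL αL br DM βM ρ T) k =
        cocycles (cochains DM βM DL αL)
          (differential βM (subadjacentBracket DM ρ T) DL (inducedAction br DM ρ T)) k ∧
      coboundaries (cochains DM βM DL αL) (oDifferential DL αL br DM βM ρ T) k =
        coboundaries (cochains DM βM DL αL)
          (differential βM (subadjacentBracket DM ρ T) DL (inducedAction br DM ρ T)) k ∧
      ∃ e : Cohomology (cochains DM βM DL αL) (oDifferential DL αL br DM βM ρ T) k ≃ₗ[ℂ]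
          Cohomology (cochains DM βM DL αL)
            (differential βM (subadjacentBracket DM ρ T) DL (inducedAction br DM ρ T)) k,
        ∀ (P : PreCochain k M L)
          (h₁ : P ∈ cocycles (cochains DM βM DL αL) (oDifferential DL αL br DM βM ρ T) k)
          (h₂ : P ∈ cocycles (cochains DM βM DL αL)
            (differential βM (subadjacentBracket DM ρ T) DL (inducedAction br DM ρ T)) k),
          e (Submodule.Quotient.mk ⟨P, h₁⟩) = Submodule.Quotient.mk ⟨P, h₂⟩) := by
  have hD (k : ℕ) (P : PreCochain k M L) := oDifferential_eq (αL := αL) (βM := βM) hL hT P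
  have hunit (k : ℕ) : IsUnit ((-1 : ℂ) ^ (k + 1)) := (isUnit_one.neg).pow _
  have hmem (k : ℕ) (P) (hP : P ∈ cochains DM βM DL αL k) :
      differential βM (subadjacentBracket DM ρ T) DL (inducedAction br DM ρ T) k P ∈
        cochains DM βM DL αL (k + 1) := by
    have := oDifferential_mem_cochains hL hρ hT hP
    rw [hD] at this
    exact (Submodule.smul_mem_iff _ (hunit k).ne_zero).1 this
  have hcoc (k : ℕ) : cocycles (cochains DM βM DL αL) (oDifferential DL αL br DM βM ρ T) k =
      cocycles (cochains DM βM DL αL)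
        (differential βM (subadjacentBracket DM ρ T) DL (inducedAction br DM ρ T)) k := by
    ext P
    simp only [cocycles, Submodule.mem_inf, LinearMap.mem_ker, hD, smul_eq_zero,
      (hunit k).ne_zero, false_or]
  have hcob (k : ℕ) : coboundaries (cochains DM βM DL αL) (oDifferential DL αL br DM βM ρ T) k =
      coboundaries (cochains DM βM DL αL)
        (differential βM (subadjacentBracket DM ρ T) DL (inducedAction br DM ρ T)) k := by
    cases k with
    | zero => rfl
    | succ k =>
      have e : oDifferential DL αL br DM βM ρ T k = (-1 : ℂ) ^ (k + 1) •
          differential βM (subadjacentBracket DM ρ T) DL (inducedAction br DM ρ T) k :=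
        LinearMap.ext (hD k)
      exact (congrArg ((cochains DM βM DL αL k).map ·) e).trans
        (Submodule.map_smul _ _ _ (hunit k).ne_zero)
  exact ⟨isHomLieConformal_subadjacentBracket hρ hT, isRepresentation_inducedAction hL hρ hT,
    fun k P hP => ⟨hmem k P hP, oDifferential_mem_cochains hL hρ hT hP,
      by rw [hD, derivedBracket_eq hL hT], hD k P⟩,
    fun k => ⟨hcoc k, hcob k, exists_quotient_equiv (hcoc k) (hcob k)⟩⟩
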